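/- \textbf{Setting.} Let $q\ge 2$ and $L\ge 1$. Consider a periodic chain of $2L$ qudits of local dimension $q$ at the positions $x\in\tfrac12\mathbb Z_{2L}$ (positions are taken modulo $L$). One time step of the circuit is $\mathbb U(\tau)=\prod_{x\in\mathbb Z_L+1/2}U(x,\tau+\tfrac12)_x\prod_{x\in\mathbb Z_L}U(x,\tau)_x$, where the gate $U(x,\tau)_x$ acts on the sites $x,x+\tfrac12$. All gates are independent, uniformly random permutation matrices of the $q^2$ two-site computational basis states; $\langle\cdot\rangle_{\rm RPC}$ is the average over them. Put $\mathbb U=\mathbb U(t-1)\cdots\mathbb U(0)$, write $A_{(x)}$ for the one-site operator $A$ acting at site $x$, and let $|\flat\rangle=q^{-1/2}\sum_i|i\rangle$. A \emph{perturbation} is a $q\times q$ matrix $\mathcal O_\alpha$ with $\operatorname{tr}\mathcal O_\alpha=0$ and $\langle\flat|\mathcal O_\alpha=\langle\flat|$. Its \emph{decorrelator} is $$D(x,t)=1-q^{-2L}\operatorname{tr}\big[\mathcal O_f(x)\,\mathbb U\,(\mathcal O_\alpha)_{(0)}\,\mathbb U^\dagger\big],$$ where $\mathcal O_f(x)$ is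 $q^{2L-1}$ times the operator that is the identity on site $x$ and $|\flat\rangle\langle\flat|$ on every other site. An \emph{observable} is a traceless Hermitian $q\times q$ matrix $\mathcal O$ with $\operatorname{tr}\mathcal O\mathcal O^\dagger=q$. For a diagonal observable $\mathcal O_d$ and any observable $\mathcal O_\nu$ let $$O_{d\nu}(x,t)=\frac{1}{2\operatorname{tr}\mathbb 1}\operatorname{tr}\Big|\big[\mathbb U^\dagger(\mathcal O_d)_{(x)}\mathbb U,(\mathcal O_\nu)_{(0)}\big]\Big|^2,\qquad |A|^2=AA^\dagger,\qquad o_{\nu,2}=\frac1q\sum_i\langle i|\mathcal O_\nu|i\rangle^2 .$$ For integers $x,y\ge1$ and $0\le k\le y$ let $d(x,y,k)$ be $\sqrt q^{\,x+y-1}$ times the contraction of the following network. Its gates are $x\times y$ copies of the averaged gate $\mathcal Q^{(2)}=\frac{1}{(q^2)!}\sum_U U\otimes U$ (sum over permutation gates), labelled $(i,j)$ with $0\le i<x$, $0\le j<y$. Line $i$ (of $x$) enters gate $(i,0)$ at its lower right leg and passes upwards to the left through $(i,0),\dots,(i,y-1)$; line $j$ (of $y$) enters gate $(0,j)$ at its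 lower left leg and passes upwards to the right through $(0,j),\dots,(x-1,j)$. At the bottom, line $i=0$ starts in $|\flat^{(2)}\rangle=\frac1q\sum_{r,s}|r\,s\rangle$ and all other lines start in $|\circ^{(2)}\rangle=\frac1{\sqrt q}\sum_s|s\,s\rangle$. At the top, the lines $j\ge y-k$ end in $|\circ^{(2)}\rangle$ and all other lines end in $|\flat^{(2)}\rangle$. For integers $x,y$ let $A_{x,y}(z)=\sum_{s=1}^{y}\binom{x-1+y-s}{x-1}z^s+\delta_{x,0}\delta_{y,0}$, where the sum is empty for $y\le0$ and the binomial coefficient is read as $\binom{x-1+y-s}{y-s}$ when $x\le 0$. With $\alpha=1+q$ put $$F(x,t)=\frac{q}{q^2-1}\Big[\frac{\sqrt q}{1+q}\Big]^{4t}\big(A_{t-x+1,t+x}(\alpha)A_{t+x-1,t-x+1}(\alpha)-A_{t-x+1,t+x-1}(\alpha)A_{t+x,t-x+1}(\alpha)\big).$$ \textbf{Theorem.} \begin{enumerate} \item For every perturbation, $\langle D(x,0)\rangle_{\rm RPC}=\delta_{x,0}$ at every site $x$. \item For all sites $x$ and times $t\in\mathbb N$, $\langle D(x,t)\rangle_{\rm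 RPC}$ is the same for all perturbations. \item For every perturbation and integers $x,t$ with $0<2t\le L$ and $-t<x\le t$, $$\langle D(x,t)\rangle_{\rm RPC}=\frac{q}{q-1}-\frac{\sqrt q}{q-1}\,d(t-x+1,t+x,1).$$ \item For every perturbation, every diagonal observable $\mathcal O_d$, every observable $\mathcal O_\nu$ with $o_{\nu,2}\ne1$, every site $x$ (integer or half-odd-integer) and every integer $t>0$, $$\langle D(x,t)\rangle_{\rm RPC}=\frac{1-1/q}{1-o_{\nu,2}}\,\langle O_{d\nu}(x,t)\rangle_{\rm RPC}.$$ \item For integers $x,t$ with $0<2t\le L$ and $-L<2x\le L$, and for every perturbation, every diagonal observable $\mathcal O_d$ and every observable $\mathcal O_\nu$, $$\langle O_{d\nu}(x,t)\rangle_{\rm RPC}=(1-o_{\nu,2})\,F(x,t),\qquad \langle D(x,t)\rangle_{\rm RPC}=\Big(1-\frac1q\Big)F(x,t).$$ \item For every perturbation, integer $x$ and integer $t>0$, $\langle D(x-\tfrac12,t)\rangle_{\rm RPC}=\langle D(x,t)\rangle_{\rm RPC}$. \end{enumerate} -/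

import Mathlib

open Matrix BigOperators

noncomputable section

namespace RPC

/-- Sites of the periodic chain of `2L` qudits: `j` stands for the position `x = j/2`. -/
abbrev Site (L : ℕ) : Type := ZMod (2 * L)

/-- Classical configurations, i.e. labels of the computational basis states of the chain. -/
abbrev Config (q L : ℕ) : Type := Site L → Fin q

/-- Operators on the full chain, as matrices in the computational basis (row = output). -/
abbrev ChainOp (q L : ℕ) : Type := Matrix (Config q L) (Config q L) ℂ

/-- A local gate: a permutation of the `q²` computational basis states of two qudits. -/
abbrev Gate (q : ℕ) : Type := Equiv.Perm (Fin q × Fin q)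

/-- The permutation matrix of a local gate. -/
def gateMatrix {q : ℕ} (u : Gate q) : Matrix (Fin q × Fin q) (Fin q × Fin q) ℂ :=
  Matrix.of fun s' s => if s' = u s then 1 else 0

/-- The gate `u` acting on the neighbouring sites `i` and `i + 1`, and trivially elsewhere. -/
def gateOp {q L : ℕ} [NeZero L] (i : Site L) (u : Gate q) : ChainOp q L :=
  Matrix.of fun c' c =>
    if ∀ k, k ≠ i → k ≠ i + 1 → c' k = c k then
      gateMatrix u (c' i, c' (i + 1)) (c i, c (i + 1)) else 0

/-- The `n`-th layer (half time step) of the brickwork. For `n` even the `m`-th gate acts on the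
positions `m, m + 1/2`; for `n` odd it acts on `m + 1/2, m + 1`. The factors commute. -/
def layerOp {q L : ℕ} [NeZero L] (n : ℕ) (u : Fin L → Gate q) : ChainOp q L :=
  (List.ofFn fun m : Fin L => gateOp ((2 * (m : ℕ) + n % 2 : ℕ) : Site L) (u m)).prod

/-- The first `n` layers, the later layers standing to the left. -/
def evolution {q L : ℕ} [NeZero L] : (n : ℕ) → (Fin n → Fin L → Gate q) → ChainOp q L
  | 0, _ => 1
  | n + 1, g => layerOp n (g (Fin.last n)) * evolution n fun k => g k.castSucc

/-- A realization of the circuit up to time `t`: one gate for each of the `L` bonds in each of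
the `2t` layers. -/
abbrev Circuit (q L t : ℕ) : Type := Fin (2 * t) → Fin L → Gate q

/-- The time-evolution operator from time `0` to time `t`. -/
def timeEvolution {q L t : ℕ} [NeZero L] (g : Circuit q L t) : ChainOp q L :=
  evolution (2 * t) g

/-- The average over random permutation circuits: all gates are independent and uniform. -/
def average {q L t : ℕ} (f : Circuit q L t → ℂ) : ℂ :=
  (∑ g : Circuit q L t, f g) / (Fintype.card (Circuit q L t) : ℂ)

/-- Tensor product of one-site operators. -/
def tensorOp {q L : ℕ} [NeZero L] (a : Site L → Matrix (Fin q) (Fin q) ℂ) : ChainOp q L :=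
  Matrix.of fun c' c => ∏ k, a k (c' k) (c k)

/-- The one-site operator `a` acting on the site `j`. -/
def siteOp {q L : ℕ} [NeZero L] (j : Site L) (a : Matrix (Fin q) (Fin q) ℂ) : ChainOp q L :=
  tensorOp (Function.update (fun _ => 1) j a)

/-- The normalised flat one-site state. -/
def flat (q : ℕ) : Fin q → ℂ := fun _ => ((√(q : ℝ) : ℝ) : ℂ)⁻¹

/-- Admissible perturbations: traceless and probability-conserving one-site operators. -/
structure IsPerturbation {q : ℕ} (a : Matrix (Fin q) (Fin q) ℂ) : Prop where
  traceless : a.trace = 0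
  conserving : star (flat q) ᵥ* a = star (flat q)

/-- One-site observables: Hermitian, traceless, and normalised as generalised Pauli matrices. -/
structure IsObservable {q : ℕ} (a : Matrix (Fin q) (Fin q) ℂ) : Prop where
  hermitian : a.IsHermitian
  traceless : a.trace = 0
  normalised : (a * aᴴ).trace = q

/-- The operator forcing the two copies to agree on the site `j`: up to the factor `q^(2L-1)`, it
is the identity on `j` and the projector on the flat state on all the other sites. -/
def agreeOp {q L : ℕ} [NeZero L] (j : Site L) : ChainOp q L :=
  (q : ℂ) ^ (2 * L - 1) •
    tensorOp (Function.update (fun _ => vecMulVec (flat q) (star (flat q))) j 1)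

/-- The decorrelator at site `j` and time `t` of one circuit realization: one minus the
probability that a configuration, and the copy of it that was perturbed by `a` at position `0` and
time `0`, agree on `j` after both have evolved for `t` steps. -/
def decorrelator {q L t : ℕ} [NeZero L] (a : Matrix (Fin q) (Fin q) ℂ) (j : Site L)
    (g : Circuit q L t) : ℂ :=
  1 - 1 / (q : ℂ) ^ (2 * L) *
    (agreeOp j * (timeEvolution g * siteOp 0 a * (timeEvolution g)ᴴ)).trace

/-- The averaged decorrelator. -/
def avgDecorrelator {q L : ℕ} [NeZero L] (a : Matrix (Fin q) (Fin q) ℂ) (j : Site L)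
    (t : ℕ) : ℂ :=
  average fun g : Circuit q L t => decorrelator a j g

/-- Heisenberg evolution of the one-site operator `a` at the site `j`. -/
def heisenberg {q L t : ℕ} [NeZero L] (a : Matrix (Fin q) (Fin q) ℂ) (j : Site L)
    (g : Circuit q L t) : ChainOp q L :=
  (timeEvolution g)ᴴ * siteOp j a * timeEvolution g

/-- The commutator of two operators. -/
def commutator {q L : ℕ} [NeZero L] (A B : ChainOp q L) : ChainOp q L := A * B - B * A

/-- The out-of-time-order correlator `tr |[a(j,t), b(0,0)]|² / (2 tr 1)` of one circuit
realization, where `|A|² = A Aᴴ`. -/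
def otoc {q L t : ℕ} [NeZero L] (a b : Matrix (Fin q) (Fin q) ℂ) (j : Site L)
    (g : Circuit q L t) : ℂ :=
  1 / 2 * (commutator (heisenberg a j g) (siteOp 0 b) *
    (commutator (heisenberg a j g) (siteOp 0 b))ᴴ).trace / (1 : ChainOp q L).trace

/-- The averaged out-of-time-order correlator. -/
def avgOtoc {q L : ℕ} [NeZero L] (a b : Matrix (Fin q) (Fin q) ℂ) (j : Site L) (t : ℕ) : ℂ :=
  average fun g : Circuit q L t => otoc a b j g

/-- The weight `o_{b,2}` of the diagonal part of the observable `b`. -/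
def diagWeight {q : ℕ} (b : Matrix (Fin q) (Fin q) ℂ) : ℂ :=
  1 / (q : ℂ) * ∑ i, b i i ^ 2

/-- The average of `U ⊗ U` over permutation gates. Each leg carries the labels of two replicas;
`a, b` are the incoming left and right legs and `a', b'` the outgoing ones. -/
def avgGate {q : ℕ} (a' b' a b : Fin q × Fin q) : ℂ :=
  (∑ u : Gate q, gateMatrix u (a'.1, b'.1) (a.1, b.1) * gateMatrix u (a'.2, b'.2) (a.2, b.2)) /
    (Fintype.card (Gate q) : ℂ)

/-- The two-replica state `∑ₛ |s s⟩ / √q`. -/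
def circle₂ {q : ℕ} (s : Fin q × Fin q) : ℂ :=
  if s.1 = s.2 then ((√(q : ℝ) : ℝ) : ℂ)⁻¹ else 0

/-- The two-replica state `∑ₛᵣ |s r⟩ / q`. -/
def flat₂ {q : ℕ} (_ : Fin q × Fin q) : ℂ := (q : ℂ)⁻¹

/-- The diagram `d(x,y,k)`: a tilted rectangle of averaged gates `(i,j)`, `i < x`, `j < y`, gate
`(0,0)` being at the bottom, times `√q^(x+y-1)`. The line `i` (of `x`) moves to the upper left
through the gates `(i,0), …, (i,y-1)` and carries the labels `l i 0, …, l i y`; the line `j`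
(of `y`) moves to the upper right through the gates `(0,j), …, (x-1,j)` and carries the labels
`r j 0, …, r j x`. At the bottom, the line `i = 0` starts in the flat state and all others in
the circle state. At the top, the `k` lines `j ≥ y - k` end in the circle state and all others in
the flat state. -/
def dDiagram (q x y k : ℕ) : ℂ :=
  ((√(q : ℝ) : ℝ) : ℂ) ^ (x + y - 1) *
    ∑ l : Fin x → Fin (y + 1) → Fin q × Fin q, ∑ r : Fin y → Fin (x + 1) → Fin q × Fin q,
      (∏ i : Fin x, ∏ j : Fin y,
        avgGate (l i j.succ) (r j i.succ) (r j i.castSucc) (l i j.castSucc)) *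
      (∏ j : Fin y, circle₂ (r j 0)) *
      (∏ i : Fin x, if (i : ℕ) = 0 then flat₂ (l i 0) else circle₂ (l i 0)) *
      (∏ i : Fin x, flat₂ (l i (Fin.last y))) *
      (∏ j : Fin y, if y ≤ (j : ℕ) + k then circle₂ (r j (Fin.last x))
        else flat₂ (r j (Fin.last x)))

/-- `A_{x,y}(z) = ∑_{s=1}^{y} C(x-1+y-s, x-1) z^s + δ_{x,0} δ_{y,0}`. The binomial coefficient
`C(n, x-1)`, `n = x-1+y-s`, is written as `C(n, n-(x-1)) = C(n, y-s)`, which gives it the usual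
meaning for `x = 0` as well, namely `C(n, -1) = δ_{n,-1}`. The sum is empty for `y ≤ 0`. -/
def A (x y : ℤ) (z : ℂ) : ℂ :=
  ∑ s ∈ Finset.Icc 1 y, ((Ring.choose (x - 1 + y - s) (y - s).toNat : ℤ) : ℂ) * z ^ s.toNat +
    if x = 0 ∧ y = 0 then 1 else 0

/-- The common closed form of the averaged decorrelator and OTOC, without their prefactors. -/
def closedForm (q : ℕ) (x : ℤ) (t : ℕ) : ℂ :=
  (q : ℂ) / ((q : ℂ) ^ 2 - 1) * (((√(q : ℝ) : ℝ) : ℂ) / (1 + q)) ^ (4 * t) *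
    (A (t - x + 1) (t + x) (1 + q) * A (t + x - 1) (t - x + 1) (1 + q) -
      A (t - x + 1) (t + x - 1) (1 + q) * A (t + x) (t - x + 1) (1 + q))

end RPC

end

namespace RPC

/-! A permutation circuit acts on the computational basis by a bijection `E` of configurations, so
both correlators concern two copies `c`, `c'` that evolve under the same circuit and initially
differ at most at site 0. Uniform gates absorb every sitewise relabelling. Hence, for copies that do
differ there, the probability `w` of later agreement at `j` depends neither on `c` nor on the
changed value (`exists_evolMean_agree`). Unit column sums and zero trace of the perturbation then
give `1 - w` for the averaged decorrelator (`avgDecorrelator_eq`). In the OTOC, a diagonal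
observable `d` enters through the squared difference of its values at `j` in the two copies. The
last gate on `j` averages any function of the two values that vanishes on agreement to a multiple of
the disagreement indicator, so the OTOC is a constant times `1 - w` as well (`avgOtoc_eq`).

To find `w`, the indicator of agreement on a set of sites is evolved backwards. A gate with both
legs in the set preserves agreement. A gate with one leg in it produces `1/(q+1)` plus `q/(q+1)`
times agreement on both legs, because distinct inputs agree on a given output leg with probability
`1/(q+1)`. An interval therefore stays an interval: its ends walk independently, outwards with
probability `q/(q+1)`, until they meet. Disagreement survives if they do not meet and the final
interval contains site 0. The probability of this is a 2×2 determinant of one-walker probabilities,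
whose exchanged term carries the weight `q^(-length)` (`evolMean_agree_interval`). The bounds on `L`
exclude winding around the ring.

Pascal's rule for the polynomials `A` is the recursion of the same walk (`A_eq_walk`), which gives
the closed form. The diagram `d`, contracted gate by gate from the top, leads to the same pair of
walks on a rectangular lattice. Only the line that starts flat can disagree at the bottom, which is
the origin of the factor `1 - 1/q` (`sum_rectDist_window`, `dDiagram_eq`). The diagrammatic formula
follows by comparing the two determinants. -/

/-! ### Uniform means -/

/-- The mean of a function over a finite type. -/
noncomputable def mean {ι : Type*} [Fintype ι] (F : ι → ℂ) : ℂ := (∑ i, F i) / (Fintype.card ι : ℂ)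

section mean
variable {ι κ : Type*} [Fintype ι] [Fintype κ]

lemma mean_const [Nonempty ι] (z : ℂ) : mean (fun _ : ι => z) = z := by
  simp [mean]

lemma mean_add (F G : ι → ℂ) : mean (fun i => F i + G i) = mean F + mean G := by
  simp [mean, Finset.sum_add_distrib, add_div]

lemma mean_sub (F G : ι → ℂ) : mean (fun i => F i - G i) = mean F - mean G := by
  simp [mean, Finset.sum_sub_distrib, sub_div]

lemma mean_mul_left (z : ℂ) (F : ι → ℂ) : mean (fun i => z * F i) = z * mean F := by
  simp [mean, ← Finset.mul_sum, mul_div_assoc]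

lemma mean_sum {β : Type*} (s : Finset β) (F : β → ι → ℂ) :
    mean (fun i => ∑ b ∈ s, F b i) = ∑ b ∈ s, mean (F b) := by
  simp only [mean, Finset.sum_div]
  exact Finset.sum_comm

lemma mean_equiv (e : ι ≃ κ) (F : κ → ℂ) : mean (fun i => F (e i)) = mean F := by
  simp only [mean, Fintype.card_congr e, Equiv.sum_comp e F]

lemma mean_pi_prod {n : ℕ} (F : Fin n → ι → ℂ) :
    mean (fun u : Fin n → ι => ∏ m, F m (u m)) = ∏ m, mean (F m) := by
  simp only [mean, Finset.prod_div_distrib, Fintype.card_pi, Nat.cast_prod]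
  rw [Finset.prod_univ_sum]
  simp

lemma mean_snoc {n : ℕ} (F : (Fin (n + 1) → ι) → ℂ) :
    mean F = mean fun g : Fin n → ι => mean fun u => F (Fin.snoc g u) := by
  simp only [mean, ← Finset.sum_div]
  rw [div_div, ← (Fin.snocEquiv fun _ => ι).sum_comp, Fintype.sum_prod_type, Finset.sum_comm]
  simp [Fin.snocEquiv, pow_succ, mul_comm]

end mean

/-! ### Averages over permutations of a pair of distinct points -/

/-- Two swaps suffice: the second one leaves `r` in place because it moves only two points different
from `r`. -/
lemma exists_perm_pair {α : Type*} [DecidableEq α] {p p' r r' : α} (h : p ≠ p') (h' : r ≠ r') :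
    ∃ σ : Equiv.Perm α, σ p = r ∧ σ p' = r' := by
  refine ⟨Equiv.swap (Equiv.swap p r p') r' * Equiv.swap p r, ?_, ?_⟩
  · have h1 : Equiv.swap p r p' ≠ r := fun e => h (by
      have := congrArg (Equiv.swap p r) e
      simpa using this.symm)
    simp [Equiv.swap_apply_of_ne_of_ne h1.symm h']
  · simp

/-- Double counting over ordered pairs of distinct points. By two-transitivity every pair
contributes the same sum over `u`; for fixed `u`, the pairs are merely permuted. -/
lemma sum_perm_pair {α : Type*} [Fintype α] [DecidableEq α] (F : α → α → ℂ) {p p' : α}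
    (h : p ≠ p') :
    ((Fintype.card α : ℂ) * (Fintype.card α - 1)) * ∑ u : Equiv.Perm α, F (u p) (u p') =
      (Fintype.card (Equiv.Perm α) : ℂ) * ∑ a, ∑ b, if a = b then 0 else F a b := by
  have h1 : ∀ r r' : α, (if r = r' then 0 else ∑ u : Equiv.Perm α, F (u r) (u r')) =
      if r = r' then 0 else ∑ u : Equiv.Perm α, F (u p) (u p') := by
    intro r r'
    split_ifs with hr
    · rfl
    · obtain ⟨σ, rfl, rfl⟩ := exists_perm_pair h hr
      exact Equiv.sum_comp (Equiv.mulRight σ) (fun u : Equiv.Perm α => F (u p) (u p'))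
  have h2 : ∑ r, ∑ r', (if r = r' then 0 else ∑ u : Equiv.Perm α, F (u r) (u r')) =
      ∑ u : Equiv.Perm α, ∑ a, ∑ b, if a = b then 0 else F a b := by
    have : ∀ r r' : α, (if r = r' then 0 else ∑ u : Equiv.Perm α, F (u r) (u r')) =
        ∑ u : Equiv.Perm α, if u r = u r' then 0 else F (u r) (u r') := by
      intro r r'
      by_cases hr : r = r' <;> simp [hr]
    simp only [this]
    rw [Finset.sum_congr rfl fun r _ => Finset.sum_comm, Finset.sum_comm]
    refine Finset.sum_congr rfl fun u _ => ?_
    rw [← Equiv.sum_comp u fun a => ∑ b, if a = b then 0 else F a b]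
    refine Finset.sum_congr rfl fun r _ => ?_
    rw [← Equiv.sum_comp u fun b => if u r = b then 0 else F (u r) b]
  simp only [h1] at h2
  have h3 : ∀ (z : ℂ) (r : α), ∑ r', (if r = r' then 0 else z) = (Fintype.card α - 1) * z := by
    intro z r
    have : ∀ r' : α, (if r = r' then 0 else z) = z - if r = r' then z else 0 := by
      intro r'; split_ifs <;> simp
    simp [this, Finset.sum_sub_distrib, sub_mul]
  simp only [h3, Finset.sum_const, Finset.card_univ, nsmul_eq_mul] at h2
  rw [← h2]; ring

section gate
variable {q : ℕ}

lemma mean_gate_pair (hq : 2 ≤ q) (F : Fin q × Fin q → Fin q × Fin q → ℂ) (h0 : ∀ a, F a a = 0)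
    (p p' : Fin q × Fin q) :
    mean (fun u : Gate q => F (u p) (u p')) =
      if p = p' then 0 else (∑ a, ∑ b, F a b) / ((q : ℂ) ^ 2 * ((q : ℂ) ^ 2 - 1)) := by
  split_ifs with h
  · subst h; simp [mean, h0]
  · have := sum_perm_pair F h
    have e : ∀ a b, (if a = b then 0 else F a b) = F a b := by
      intro a b; split_ifs with hab
      · rw [hab, h0]
      · rfl
    simp only [e] at this
    have hq2 : (1 : ℝ) < (q : ℝ) ^ 2 := by
      have : (2 : ℝ) ≤ q := by exact_mod_cast hq
      nlinarith
    have hc : (Fintype.card (Gate q) : ℂ) ≠ 0 := by exact_mod_cast Fintype.card_ne_zero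
    have n1 : (q : ℂ) ^ 2 - 1 ≠ 0 := by
      intro h; have h' : ((q : ℝ) ^ 2 - 1 : ℝ) = 0 := by exact_mod_cast h
      linarith
    have n2 : (q : ℂ) ≠ 0 := by
      have : q ≠ 0 := by omega
      exact_mod_cast this
    rw [mean, div_eq_div_iff hc (mul_ne_zero (pow_ne_zero _ n2) n1)]
    simp only [Fintype.card_prod, Fintype.card_fin, Nat.cast_mul] at this
    rw [mul_comm (∑ a, ∑ b, F a b), ← this]
    ring

lemma natCast_ne (hq : 2 ≤ q) : (q : ℂ) ≠ 0 ∧ (q : ℂ) - 1 ≠ 0 ∧ (q : ℂ) + 1 ≠ 0 := by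
  refine ⟨?_, ?_, ?_⟩
  · have : q ≠ 0 := by omega
    exact_mod_cast this
  · rw [sub_ne_zero]
    have : q ≠ 1 := by omega
    exact_mod_cast this
  · exact_mod_cast Nat.succ_ne_zero q

lemma mean_gate_fst (hq : 2 ≤ q) (H : Fin q → Fin q → ℂ) (h0 : ∀ a, H a a = 0)
    (p p' : Fin q × Fin q) :
    mean (fun u : Gate q => H (u p).1 (u p').1) =
      if p = p' then 0 else (∑ r, ∑ s, H r s) / ((q : ℂ) ^ 2 - 1) := by
  rw [mean_gate_pair hq (fun a b => H a.1 b.1) (fun a => h0 _)]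
  congr 1
  obtain ⟨n0, n1, n2⟩ := natCast_ne hq
  simp only [Fintype.sum_prod_type, Finset.sum_const, Finset.card_univ, Fintype.card_fin,
    nsmul_eq_mul, ← Finset.mul_sum]
  rw [← mul_assoc, ← sq]
  exact mul_div_mul_left _ _ (pow_ne_zero _ n0)

lemma mean_gate_snd (hq : 2 ≤ q) (H : Fin q → Fin q → ℂ) (h0 : ∀ a, H a a = 0)
    (p p' : Fin q × Fin q) :
    mean (fun u : Gate q => H (u p).2 (u p').2) =
      if p = p' then 0 else (∑ r, ∑ s, H r s) / ((q : ℂ) ^ 2 - 1) := by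
  rw [mean_gate_pair hq (fun a b => H a.2 b.2) (fun a => h0 _)]
  congr 1
  obtain ⟨n0, n1, n2⟩ := natCast_ne hq
  simp only [Fintype.sum_prod_type, Finset.sum_const, Finset.card_univ, Fintype.card_fin,
    nsmul_eq_mul, ← Finset.mul_sum]
  rw [← mul_assoc, ← sq]
  exact mul_div_mul_left _ _ (pow_ne_zero _ n0)

/-- This is the probability that one output leg differs when the inputs differ, and hence the
outward step probability of the walks below. -/
lemma sum_differ (hq : 2 ≤ q) :
    (∑ r : Fin q, ∑ s : Fin q, if r = s then (0 : ℂ) else 1) / ((q : ℂ) ^ 2 - 1) =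
      (q : ℂ) / (q + 1) := by
  have h3 : ∀ r : Fin q, ∑ s : Fin q, (if r = s then (0 : ℂ) else 1) = q - 1 := by
    intro r
    have : ∀ s : Fin q, (if r = s then (0 : ℂ) else 1) = 1 - if r = s then 1 else 0 := by
      intro r'; split_ifs <;> simp
    simp [this, Finset.sum_sub_distrib]
  obtain ⟨n0, n1, n2⟩ := natCast_ne hq
  have : (q : ℂ) ^ 2 - 1 = (q + 1) * (q - 1) := by ring
  rw [this]
  simp only [h3, Finset.sum_const, Finset.card_univ, Fintype.card_fin, nsmul_eq_mul]
  exact mul_div_mul_right _ _ n1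

lemma one_sub_differ (hq : 2 ≤ q) (P : Prop) [Decidable P] :
    (1 : ℂ) - (if P then 0 else (q : ℂ) / (q + 1)) =
      1 / (q + 1) + (q : ℂ) / (q + 1) * if P then 1 else 0 := by
  obtain ⟨n0, n1, n2⟩ := natCast_ne hq
  split_ifs <;> field_simp <;> ring

lemma mean_gate_agree_fst (hq : 2 ≤ q) (p p' : Fin q × Fin q) :
    mean (fun u : Gate q => if (u p).1 = (u p').1 then (1 : ℂ) else 0) =
      1 / (q + 1) + (q : ℂ) / (q + 1) * if p = p' then 1 else 0 := by
  have := mean_gate_fst hq (fun r s => if r = s then 0 else 1) (by simp) p p'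
  rw [sum_differ hq] at this
  have e : ∀ u : Gate q, (if (u p).1 = (u p').1 then (1 : ℂ) else 0) =
      1 - if (u p).1 = (u p').1 then 0 else 1 := fun u => by split_ifs <;> simp
  simp only [e]
  rw [mean_sub, mean_const, this, one_sub_differ hq]

lemma mean_gate_agree_snd (hq : 2 ≤ q) (p p' : Fin q × Fin q) :
    mean (fun u : Gate q => if (u p).2 = (u p').2 then (1 : ℂ) else 0) =
      1 / (q + 1) + (q : ℂ) / (q + 1) * if p = p' then 1 else 0 := by
  have := mean_gate_snd hq (fun r s => if r = s then 0 else 1) (by simp) p p'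
  rw [sum_differ hq] at this
  have e : ∀ u : Gate q, (if (u p).2 = (u p').2 then (1 : ℂ) else 0) =
      1 - if (u p).2 = (u p').2 then 0 else 1 := fun u => by split_ifs <;> simp
  simp only [e]
  rw [mean_sub, mean_const, this, one_sub_differ hq]

end gate

/-! ### A biased random walk -/

/-- The probability that a walk started at `l` is at a nonpositive position after `n` steps, where
a step leads to the left with probability `q / (q + 1)`. -/
noncomputable def walk (q : ℕ) : ℕ → ℤ → ℂ
  | 0, l => if l ≤ 0 then 1 else 0
  | n + 1, l => (q * walk q n (l - 1) + walk q n (l + 1)) / (q + 1)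

lemma walk_eq_zero (q : ℕ) (n : ℕ) : ∀ l : ℤ, (n : ℤ) < l → walk q n l = 0 := by
  induction n with
  | zero => intro l h; rw [walk, if_neg (by omega)]
  | succ n ih =>
    intro l h
    push_cast at h
    rw [walk, ih _ (by linarith), ih _ (by linarith)]; simp

lemma walk_eq_one (q : ℕ) (n : ℕ) : ∀ l : ℤ, l ≤ -(n : ℤ) → walk q n l = 1 := by
  have n2 : (q : ℂ) + 1 ≠ 0 := by exact_mod_cast Nat.succ_ne_zero q
  induction n with
  | zero => intro l h; rw [walk, if_pos (by omega)]
  | succ n ih =>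
    intro l h
    push_cast at h
    rw [walk, ih _ (by linarith), ih _ (by linarith), mul_one, div_self n2]

/-! ### The circuit as a map on configurations -/

/-- The matrix of a map on configurations. -/
noncomputable def mapOp {q L : ℕ} (E : Config q L → Config q L) : ChainOp q L :=
  open Classical in Matrix.of fun c' c => if c' = E c then 1 else 0

lemma mapOp_mul {q L : ℕ} [NeZero L] (E E' : Config q L → Config q L) :
    mapOp E * mapOp E' = mapOp (E ∘ E') := by
  ext c' c
  simp [mapOp, Matrix.mul_apply]

lemma mapOp_id {q L : ℕ} [NeZero L] : mapOp (id : Config q L → Config q L) = 1 := by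
  ext c' c
  simp [mapOp, Matrix.one_apply]

section maps
set_option linter.unusedSectionVars false
variable {q L : ℕ} [NeZero L]

lemma site_one_ne_zero : (1 : Site L) ≠ 0 := by
  have : Fact (1 < 2 * L) := ⟨by have := NeZero.pos L; omega⟩
  exact one_ne_zero

lemma site_ne_succ (i : Site L) : i ≠ i + 1 := by
  intro h
  exact site_one_ne_zero (L := L) (by simpa using h.symm)

/-- The action of the gate `u` on the sites `i` and `i + 1` of a configuration. -/
def gateMap (i : Site L) (u : Gate q) (c : Config q L) : Config q L := fun k =>
  if k = i then (u (c i, c (i + 1))).1 else if k = i + 1 then (u (c i, c (i + 1))).2 else c k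

lemma gateMap_left (i : Site L) (u : Gate q) (c : Config q L) :
    gateMap i u c i = (u (c i, c (i + 1))).1 := by simp [gateMap]

lemma gateMap_right (i : Site L) (u : Gate q) (c : Config q L) :
    gateMap i u c (i + 1) = (u (c i, c (i + 1))).2 := by
  simp [gateMap, (site_ne_succ i).symm]

lemma gateMap_of_ne (i : Site L) (u : Gate q) (c : Config q L) {k : Site L} (h : k ≠ i)
    (h' : k ≠ i + 1) : gateMap i u c k = c k := by simp [gateMap, h, h']

lemma gateMap_injective (i : Site L) (u : Gate q) :
    Function.Injective (gateMap i u : Config q L → Config q L) := by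
  intro c c' h
  have h1 := congrFun h i
  have h2 := congrFun h (i + 1)
  rw [gateMap_left, gateMap_left] at h1
  rw [gateMap_right, gateMap_right] at h2
  have h3 := u.injective (Prod.ext h1 h2)
  rw [Prod.mk.injEq] at h3
  funext k
  by_cases hk : k = i
  · rw [hk, h3.1]
  by_cases hk' : k = i + 1
  · rw [hk', h3.2]
  simpa [gateMap_of_ne i u _ hk hk'] using congrFun h k

lemma gateOp_eq_mapOp (i : Site L) (u : Gate q) : gateOp i u = mapOp (gateMap i u) := by
  ext c' c
  simp only [gateOp, mapOp, gateMatrix, Matrix.of_apply]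
  by_cases h : c' = gateMap i u c
  · subst h
    rw [if_pos fun k hk hk' => gateMap_of_ne i u c hk hk']
    simp [gateMap_left, gateMap_right]
  · rw [if_neg h]
    split_ifs with h1 h2
    · refine absurd ?_ h
      rw [Prod.ext_iff] at h2
      funext k
      by_cases hk : k = i
      · rw [hk, gateMap_left]; exact h2.1
      by_cases hk' : k = i + 1
      · rw [hk', gateMap_right]; exact h2.2
      rw [gateMap_of_ne i u c hk hk', h1 k hk hk']
    · rfl
    · rfl

/-- The successive action of several gates, the first one acting last. -/
def gatesMap : (n : ℕ) → (Fin n → Site L) → (Fin n → Gate q) → Config q L → Config q L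
  | 0, _, _ => id
  | n + 1, s, u => gateMap (s 0) (u 0) ∘ gatesMap n (fun m => s m.succ) fun m => u m.succ

lemma prod_gateOp (n : ℕ) (s : Fin n → Site L) (u : Fin n → Gate q) :
    (List.ofFn fun m => gateOp (s m) (u m)).prod = mapOp (gatesMap n s u) := by
  induction n with
  | zero => simp [gatesMap, mapOp_id]
  | succ n ih =>
    rw [List.ofFn_succ, List.prod_cons, ih, gateOp_eq_mapOp, mapOp_mul, gatesMap]

lemma gatesMap_injective (n : ℕ) (s : Fin n → Site L) (u : Fin n → Gate q) :
    Function.Injective (gatesMap n s u) := by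
  induction n with
  | zero => exact Function.injective_id
  | succ n ih => exact (gateMap_injective _ _).comp (ih _ _)

lemma gatesMap_of_ne (n : ℕ) (s : Fin n → Site L) (u : Fin n → Gate q) (c : Config q L)
    {k : Site L} (h : ∀ m, k ≠ s m ∧ k ≠ s m + 1) : gatesMap n s u c k = c k := by
  induction n with
  | zero => rfl
  | succ n ih =>
    rw [gatesMap, Function.comp_apply, gateMap_of_ne _ _ _ (h 0).1 (h 0).2]
    exact ih _ _ fun m => h m.succ

/-- The supports are disjoint, so each gate sees the original values whatever the order of the
product. -/
lemma gatesMap_apply (n : ℕ) (s : Fin n → Site L) (u : Fin n → Gate q) (c : Config q L)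
    (hs : ∀ m m', m ≠ m' → s m ≠ s m' ∧ s m ≠ s m' + 1) (m : Fin n) :
    (gatesMap n s u c (s m), gatesMap n s u c (s m + 1)) = u m (c (s m), c (s m + 1)) := by
  induction n with
  | zero => exact m.elim0
  | succ n ih =>
    rw [gatesMap, Function.comp_apply]
    have hs' : ∀ m m', m ≠ m' → s m + 1 ≠ s m' ∧ s m + 1 ≠ s m' + 1 := fun m m' h =>
      ⟨(hs m' m h.symm).2.symm, fun e => (hs m m' h).1 (add_right_cancel e)⟩
    refine Fin.cases ?_ (fun m => ?_) m
    · rw [gateMap_left, gateMap_right, gatesMap_of_ne, gatesMap_of_ne]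
      · intro m; exact hs' _ _ (Fin.succ_ne_zero m).symm
      · intro m; exact hs _ _ (Fin.succ_ne_zero m).symm
    · have h := Fin.succ_ne_zero m
      rw [gateMap_of_ne _ _ _ (hs _ _ h).1 (hs _ _ h).2,
        gateMap_of_ne _ _ _ (hs' _ _ h).1 (hs' _ _ h).2]
      exact ih _ _ (fun m m' h => hs _ _ ((Fin.succ_injective n).ne h)) m

/-- The left site of the `m`-th gate of the `n`-th layer. -/
def bond (L n : ℕ) (m : Fin L) : Site L := ((2 * (m : ℕ) + n % 2 : ℕ) : Site L)

/-- The action of the `n`-th layer on configurations. -/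
def layerMap (n : ℕ) (u : Fin L → Gate q) : Config q L → Config q L := gatesMap L (bond L n) u

/-- The action of the first `n` layers on configurations. -/
def evolMap : (n : ℕ) → (Fin n → Fin L → Gate q) → Config q L → Config q L
  | 0, _ => id
  | n + 1, g => layerMap n (g (Fin.last n)) ∘ evolMap n fun k => g k.castSucc

lemma evolution_eq_mapOp (n : ℕ) (g : Fin n → Fin L → Gate q) :
    evolution n g = mapOp (evolMap n g) := by
  induction n with
  | zero => exact mapOp_id.symm
  | succ n ih =>
    rw [evolution, ih, evolMap, ← mapOp_mul]
    congr 1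
    exact prod_gateOp L (bond L n) _

lemma evolMap_injective (n : ℕ) (g : Fin n → Fin L → Gate q) :
    Function.Injective (evolMap n g) := by
  induction n with
  | zero => exact Function.injective_id
  | succ n ih => exact (gatesMap_injective _ _ _).comp (ih _)

/-- The coordinate of a site relative to the base point `b`. -/
def offset (b k : Site L) : ℕ := (k - b).val

lemma offset_lt (b k : Site L) : offset b k < 2 * L := ZMod.val_lt _

lemma offset_injective (b : Site L) : Function.Injective (offset b) := fun _ _ h =>
  sub_left_injective (ZMod.val_injective _ h)

lemma offset_add (b : Site L) {v : ℕ} (h : v < 2 * L) : offset b (b + (v : Site L)) = v := by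
  rw [offset, add_sub_cancel_left, ZMod.val_natCast, Nat.mod_eq_of_lt h]

lemma add_offset (b k : Site L) : b + (offset b k : Site L) = k := by
  rw [offset, ZMod.natCast_zmod_val]; abel

lemma offset_succ (b k : Site L) (h : offset b k + 1 < 2 * L) :
    offset b (k + 1) = offset b k + 1 := by
  conv_lhs => rw [← add_offset b k, add_assoc, ← Nat.cast_succ]
  exact offset_add b h

/-- Relative to a base point of the same parity, the bonds of a layer are `(2m, 2m + 1)`. -/
lemma offset_bond_even (n : ℕ) (l : ℤ) (h : Even (l + n)) (m : Fin L) :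
    Even (offset (l : Site L) (bond L n m)) := by
  have : bond L n m - (l : Site L) = ((2 * (m : ℤ) + (n % 2 : ℕ) - l : ℤ) : Site L) := by
    simp only [bond, Nat.cast_add, Nat.cast_mul, Int.cast_sub, Int.cast_add, Int.cast_mul,
      Int.cast_natCast, Int.cast_ofNat, Nat.cast_ofNat]
  rw [offset, this, ← Int.even_coe_nat, ZMod.val_intCast]
  obtain ⟨r, hr⟩ := h
  -- Reduction modulo `2 * L` preserves parity, so parity makes sense on the ring.
  rw [Int.even_iff, Int.emod_emod_of_dvd _ (by simp)]
  omega

lemma offset_bond_succ (n : ℕ) (l : ℤ) (h : Even (l + n)) (m : Fin L) :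
    offset (l : Site L) (bond L n m + 1) = offset (l : Site L) (bond L n m) + 1 := by
  apply offset_succ
  have h1 := offset_bond_even n l h m
  have h2 := offset_lt (l : Site L) (bond L n m)
  rw [Nat.even_iff] at h1
  omega

lemma bond_injective (n : ℕ) : Function.Injective (bond L n) := by
  intro m m' h
  have e : ∀ m : Fin L, offset ((n % 2 : ℕ) : Site L) (bond L n m) = 2 * m := fun m => by
    rw [bond, Nat.cast_add, add_comm, offset_add _ (by omega)]
  have := e m
  rw [h, e m'] at this
  exact Fin.ext (by omega)

lemma exists_bond (n : ℕ) (k : Site L) : ∃ m, k = bond L n m ∨ k = bond L n m + 1 := by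
  set v := offset ((n % 2 : ℕ) : Site L) k with hv
  have hlt : v < 2 * L := offset_lt _ _
  refine ⟨⟨v / 2, by omega⟩, ?_⟩
  have hk := add_offset ((n % 2 : ℕ) : Site L) k
  rw [← hv] at hk
  rcases Nat.even_or_odd' v with ⟨r, hr | hr⟩
  · left
    refine hk.symm.trans ?_
    rw [bond, ← Nat.cast_add]
    congr 1
    dsimp only
    omega
  · right
    refine hk.symm.trans ?_
    rw [bond, ← Nat.cast_add, ← Nat.cast_succ]
    congr 1
    dsimp only
    omega

lemma exists_bond_eq (n : ℕ) (l : ℤ) (h : Even (l + n)) {v : ℕ} (hv : Even v) (hlt : v < 2 * L) :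
    ∃ m, offset (l : Site L) (bond L n m) = v := by
  obtain ⟨m, hm | hm⟩ := exists_bond n ((l : Site L) + (v : Site L))
  · exact ⟨m, by rw [← hm, offset_add _ hlt]⟩
  · have h1 := offset_bond_succ n l h m
    have h2 := offset_bond_even n l h m
    rw [← hm, offset_add _ hlt] at h1
    rw [Nat.even_iff] at hv h2
    omega

lemma bond_disjoint (n : ℕ) (m m' : Fin L) (h : m ≠ m') :
    bond L n m ≠ bond L n m' ∧ bond L n m ≠ bond L n m' + 1 := by
  refine ⟨(bond_injective n).ne h, fun e => ?_⟩
  have he : Even ((n : ℤ) + n) := ⟨n, rfl⟩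
  have h1 := offset_bond_succ n n he m'
  have h2 := offset_bond_even n n he m'
  have h3 := offset_bond_even n n he m
  rw [← e] at h1
  rw [Nat.even_iff] at h2 h3
  omega

lemma layerMap_apply (n : ℕ) (u : Fin L → Gate q) (c : Config q L) (m : Fin L) :
    (layerMap n u c (bond L n m), layerMap n u c (bond L n m + 1)) =
      u m (c (bond L n m), c (bond L n m + 1)) :=
  gatesMap_apply L _ u c (bond_disjoint n) m

end maps
/-! ### Averaged evolution of two-copy functions -/

section chain
variable {q L : ℕ} [NeZero L]
set_option linter.unusedSectionVars false

/-- The average of a two-copy function over the gates of the `n`-th layer. -/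
noncomputable def layerMean (n : ℕ) (φ : Config q L → Config q L → ℂ) (c c' : Config q L) : ℂ :=
  mean fun u : Fin L → Gate q => φ (layerMap n u c) (layerMap n u c')

/-- The average of a two-copy function over the gates of the first `n` layers. -/
noncomputable def evolMean (n : ℕ) (φ : Config q L → Config q L → ℂ) (c c' : Config q L) : ℂ :=
  mean fun g : Fin n → Fin L → Gate q => φ (evolMap n g c) (evolMap n g c')

lemma evolMean_zero (φ : Config q L → Config q L → ℂ) : evolMean 0 φ = φ := by
  ext c c'
  exact mean_const (ι := Fin 0 → Fin L → Gate q) _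

lemma evolMean_succ (n : ℕ) (φ : Config q L → Config q L → ℂ) :
    evolMean (n + 1) φ = evolMean n (layerMean n φ) := by
  ext c c'
  rw [evolMean, mean_snoc]
  simp [evolMap, evolMean, layerMean]

lemma evolMean_add (n : ℕ) (φ ψ : Config q L → Config q L → ℂ) :
    evolMean n (φ + ψ) = evolMean n φ + evolMean n ψ := by
  ext c c'; exact mean_add _ _

lemma evolMean_smul (n : ℕ) (z : ℂ) (φ : Config q L → Config q L → ℂ) :
    evolMean n (z • φ) = z • evolMean n φ := by
  ext c c'; exact mean_mul_left _ _

lemma evolMean_one (n : ℕ) : evolMean n (1 : Config q L → Config q L → ℂ) = 1 := by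
  ext c c'; exact mean_const _

/-- The indicator function of the agreement of two configurations on a set of sites. -/
noncomputable def agree (S : Set (Site L)) (c c' : Config q L) : ℂ :=
  open Classical in if ∀ k ∈ S, c k = c' k then 1 else 0

lemma agree_empty : agree (∅ : Set (Site L)) = (1 : Config q L → Config q L → ℂ) := by
  ext c c'; simp [agree]

lemma agree_eq_prod (n : ℕ) (S : Set (Site L)) (c c' : Config q L) :
    open Classical in agree S c c' = ∏ m : Fin L,
      (if bond L n m ∈ S → c (bond L n m) = c' (bond L n m) then (1 : ℂ) else 0) *
        if bond L n m + 1 ∈ S → c (bond L n m + 1) = c' (bond L n m + 1) then (1 : ℂ) else 0 := by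
  classical
  simp only [ite_zero_mul_ite_zero, mul_one]
  rw [agree]
  split_ifs with h
  · exact (Finset.prod_eq_one fun m _ => if_pos ⟨h _, h _⟩).symm
  · push Not at h
    obtain ⟨k, hk, hne⟩ := h
    obtain ⟨m, rfl | rfl⟩ := exists_bond n k
    · exact (Finset.prod_eq_zero (Finset.mem_univ m) (if_neg fun h => hne (h.1 hk))).symm
    · exact (Finset.prod_eq_zero (Finset.mem_univ m) (if_neg fun h => hne (h.2 hk))).symm

lemma layerMean_prod (n : ℕ) (c c' : Config q L)
    (F : Fin L → Fin q × Fin q → Fin q × Fin q → ℂ) :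
    layerMean n (fun d d' => ∏ m, F m (d (bond L n m), d (bond L n m + 1))
      (d' (bond L n m), d' (bond L n m + 1))) c c' =
    ∏ m, mean fun u : Gate q => F m (u (c (bond L n m), c (bond L n m + 1)))
      (u (c' (bond L n m), c' (bond L n m + 1))) := by
  rw [← mean_pi_prod]
  simp only [layerMean, layerMap_apply]

/-- The agreement of two configurations on the `m`-th bond of the `n`-th layer. -/
noncomputable def bondAgree (n : ℕ) (c c' : Config q L) (m : Fin L) : ℂ :=
  if (c (bond L n m), c (bond L n m + 1)) = (c' (bond L n m), c' (bond L n m + 1)) then 1 else 0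

/-- The gates of a layer are independent, so the average factorises over bonds. Only a bond cut by
`S` gives a nontrivial mixture; these are the sources of motion. -/
lemma layerMean_agree (hq : 2 ≤ q) (n : ℕ) (S : Set (Site L)) (c c' : Config q L) :
    open Classical in layerMean n (agree S) c c' = ∏ m : Fin L,
      if bond L n m ∈ S then
        (if bond L n m + 1 ∈ S then bondAgree n c c' m
          else 1 / ((q : ℂ) + 1) + (q : ℂ) / (q + 1) * bondAgree n c c' m)
      else if bond L n m + 1 ∈ S then 1 / ((q : ℂ) + 1) + (q : ℂ) / (q + 1) * bondAgree n c c' m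
        else 1 := by
  classical
  have e : agree S = fun d d' : Config q L => ∏ m : Fin L,
      (if bond L n m ∈ S → d (bond L n m) = d' (bond L n m) then (1 : ℂ) else 0) *
        if bond L n m + 1 ∈ S → d (bond L n m + 1) = d' (bond L n m + 1) then (1 : ℂ) else 0 := by
    ext d d'; exact agree_eq_prod n S d d'
  rw [e]
  refine (layerMean_prod n c c' fun m p p' => (if bond L n m ∈ S → p.1 = p'.1 then (1 : ℂ) else 0) *
    if bond L n m + 1 ∈ S → p.2 = p'.2 then (1 : ℂ) else 0).trans ?_
  refine Finset.prod_congr rfl fun m _ => ?_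
  by_cases h1 : bond L n m ∈ S <;> by_cases h2 : bond L n m + 1 ∈ S <;>
    simp only [h1, h2, forall_const, false_imp_iff, if_true, if_false, mul_one, one_mul]
  · simp only [ite_zero_mul_ite_zero, mul_one, ← Prod.ext_iff, EmbeddingLike.apply_eq_iff_eq]
    exact mean_const _
  · exact mean_gate_agree_fst hq _ _
  · exact mean_gate_agree_snd hq _ _
  · exact mean_const _

lemma agree_eq_prod_bondAgree (n : ℕ) (S : Set (Site L))
    (hS : ∀ m, bond L n m ∈ S ↔ bond L n m + 1 ∈ S) (c c' : Config q L) :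
    open Classical in agree S c c' = ∏ m : Fin L,
      if bond L n m ∈ S then bondAgree n c c' m else 1 := by
  classical
  rw [agree_eq_prod n]
  refine Finset.prod_congr rfl fun m _ => ?_
  have := hS m
  by_cases h1 : bond L n m ∈ S
  · have h2 := this.1 h1
    simp only [h1, h2, forall_const, bondAgree, ite_zero_mul_ite_zero, mul_one, Prod.mk.injEq,
      if_true]
  · have h2 : bond L n m + 1 ∉ S := fun h => h1 (this.2 h)
    simp [h1, h2]

/-! ### Intervals of agreement and their motion under one layer -/

/-- The `len` consecutive sites that start at `l`. -/
def interval (l : ℤ) (len : ℕ) : Set (Site L) := {k | offset (l : Site L) k < len}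

lemma mem_interval_shift (l : ℤ) (d len : ℕ) (hd : d + len ≤ 2 * L) (k : Site L) :
    k ∈ interval (l + d) len ↔ d ≤ offset (l : Site L) k ∧ offset (l : Site L) k < d + len := by
  set v := offset (l : Site L) k with hv
  have hlt : v < 2 * L := offset_lt _ _
  rw [interval, Set.mem_ofPred_eq]
  have hk : k = (l : Site L) + (v : Site L) := (add_offset _ _).symm
  by_cases h : d ≤ v
  · have : offset ((l + d : ℤ) : Site L) k = v - d := by
      have : k = ((l + d : ℤ) : Site L) + ((v - d : ℕ) : Site L) := by
        rw [hk, Nat.cast_sub h]; push_cast; ring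
      rw [this]; exact offset_add _ (by omega)
    rw [this]; omega
  · have : offset ((l + d : ℤ) : Site L) k = v + 2 * L - d := by
      have : k = ((l + d : ℤ) : Site L) + ((v + 2 * L - d : ℕ) : Site L) := by
        rw [hk, Nat.cast_sub (by omega), Nat.cast_add, ZMod.natCast_self]; push_cast; ring
      rw [this]; exact offset_add _ (by omega)
    rw [this]; omega

/-- The averaged layer moves both ends of an interval by one site, outwards or inwards. -/
lemma layerMean_agree_interval (hq : 2 ≤ q) (n : ℕ) (l : ℤ) (k : ℕ) (hl : Even (l + n))
    (hk : 2 * k + 4 ≤ 2 * L) :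
    layerMean n (agree (interval (l + 1) (2 * k + 2)) : Config q L → Config q L → ℂ) =
      (1 / ((q : ℂ) + 1) ^ 2) • ((q : ℂ) ^ 2 • agree (interval l (2 * k + 4)) +
        (q : ℂ) • agree (interval l (2 * k + 2)) + (q : ℂ) • agree (interval (l + 2) (2 * k + 2)) +
        agree (interval (l + 2) (2 * k))) := by
  classical
  ext c c'
  -- The bonds `a` and `b` are the two cut by the interval `[1, 2k+3)` in coordinates relative to
  -- `l`. All other bonds lie wholly inside or wholly outside and form the common factor `P`.
  obtain ⟨a, ha⟩ := exists_bond_eq (L := L) n l hl (v := 0) (by simp) (by omega)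
  obtain ⟨b, hb⟩ := exists_bond_eq (L := L) n l hl (v := 2 * k + 2) ⟨k + 1, by ring⟩ (by omega)
  have hab : a ≠ b := by rintro rfl; omega
  have hinj : ∀ m m', offset (l : Site L) (bond L n m) = offset (l : Site L) (bond L n m') →
      m = m' := fun m m' h => bond_injective n (offset_injective _ h)
  have split : ∀ F : Fin L → ℂ, ∏ m, F m =
      F a * F b * ∏ m ∈ (Finset.univ.erase a).erase b, F m := by
    intro F
    rw [mul_assoc, Finset.mul_prod_erase _ _ (by simp [hab.symm]),
      Finset.mul_prod_erase _ _ (Finset.mem_univ _)]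
  have mem0 : ∀ (len : ℕ), len ≤ 2 * L → ∀ z : Site L, z ∈ interval l len ↔
      offset (l : Site L) z < len := fun _ _ _ => Iff.rfl
  have mem1 := mem_interval_shift (L := L) l 1
  have mem2 := mem_interval_shift (L := L) l 2
  push_cast at mem1 mem2
  have even := offset_bond_even (L := L) n l hl
  have succ := offset_bond_succ (L := L) n l hl
  set P := ∏ m ∈ (Finset.univ.erase a).erase b,
    if 2 ≤ offset (l : Site L) (bond L n m) ∧ offset (l : Site L) (bond L n m) < 2 * k + 2 then
      bondAgree n c c' m else 1 with hP
  -- The four aligned intervals differ only in whether they include bond `a` and bond `b`. They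
  -- match the four terms in the expansion of the product of the two mixtures in `evalL`.
  have evalA : ∀ (S : Set (Site L)) (lo hi : ℕ), (lo = 0 ∨ lo = 2) → (hi = 2 * k + 2 ∨
      hi = 2 * k + 4) → (∀ z, z ∈ S ↔ lo ≤ offset (l : Site L) z ∧ offset (l : Site L) z < hi) →
      agree S c c' = (if lo = 0 then bondAgree n c c' a else 1) *
        (if hi = 2 * k + 4 then bondAgree n c c' b else 1) * P := by
    intro S lo hi hlo hhi hS
    rw [agree_eq_prod_bondAgree n S, split]
    · congr 1
      · congr 1
        · refine if_congr ?_ rfl rfl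
          rw [hS, ha]; omega
        · refine if_congr ?_ rfl rfl
          rw [hS, hb]; omega
      · refine Finset.prod_congr rfl fun m hm => if_congr ?_ rfl rfl
        have h1 : m ≠ b ∧ m ≠ a := by simpa using hm
        have h2 : offset (l : Site L) (bond L n m) ≠ 0 := fun h => h1.2 (hinj m a (h.trans ha.symm))
        have h3 : offset (l : Site L) (bond L n m) ≠ 2 * k + 2 := fun h =>
          h1.1 (hinj m b (h.trans hb.symm))
        have h4 := even m
        rw [Nat.even_iff] at h4
        rw [hS]; omega
    · intro m
      have h4 := even m
      rw [Nat.even_iff] at h4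
      rw [hS, hS, succ]; omega
  have evalL : layerMean n (agree (interval (l + 1) (2 * k + 2))) c c' =
      (1 / ((q : ℂ) + 1) + (q : ℂ) / (q + 1) * bondAgree n c c' a) *
        (1 / ((q : ℂ) + 1) + (q : ℂ) / (q + 1) * bondAgree n c c' b) * P := by
    rw [layerMean_agree hq, split]
    simp only [mem1 _ (show 1 + (2 * k + 2) ≤ 2 * L by omega), succ]
    congr 1
    · congr 1
      · rw [ha, if_neg (by omega), if_pos (by omega)]
      · rw [hb, if_pos (by omega), if_neg (by omega)]
    · refine Finset.prod_congr rfl fun m hm => ?_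
      have h1 : m ≠ b ∧ m ≠ a := by simpa using hm
      have h2 : offset (l : Site L) (bond L n m) ≠ 0 := fun h => h1.2 (hinj m a (h.trans ha.symm))
      have h3 : offset (l : Site L) (bond L n m) ≠ 2 * k + 2 := fun h =>
          h1.1 (hinj m b (h.trans hb.symm))
      have h4 := even m
      rw [Nat.even_iff] at h4
      by_cases h : 2 ≤ offset (l : Site L) (bond L n m) ∧
          offset (l : Site L) (bond L n m) < 2 * k + 2
      · rw [if_pos (by omega), if_pos (by omega), if_pos h]
      · rw [if_neg (by omega), if_neg (by omega), if_neg h]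
  rw [evalL]
  simp only [Pi.add_apply, Pi.smul_apply, smul_eq_mul]
  rw [evalA (interval l (2 * k + 4)) 0 (2 * k + 4) (by simp) (by simp)
      (fun z => by simp [interval]),
    evalA (interval l (2 * k + 2)) 0 (2 * k + 2) (by simp) (by simp)
      (fun z => by simp [interval]),
    evalA (interval (l + 2) (2 * k + 2)) 2 (2 * k + 4) (by simp) (by simp)
      (fun z => by rw [mem2 _ (by omega)]; omega),
    evalA (interval (l + 2) (2 * k)) 2 (2 * k + 2) (by simp) (by simp)
      (fun z => by rw [mem2 _ (by omega)]; omega)]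
  obtain ⟨n0, n1, n2⟩ := natCast_ne hq
  simp
  field_simp
  ring

lemma agree_pair_eq_bondAgree (n : ℕ) (m : Fin L) (c c' : Config q L) :
    agree {bond L n m, bond L n m + 1} c c' = bondAgree n c c' m := by
  simp [agree, bondAgree]

lemma layerMean_agree_singleton (hq : 2 ≤ q) (n : ℕ) (m : Fin L) (j : Site L)
    (hj : j = bond L n m ∨ j = bond L n m + 1) :
    layerMean n (agree {j} : Config q L → Config q L → ℂ) =
      (1 / ((q : ℂ) + 1)) • 1 + ((q : ℂ) / (q + 1)) • agree {bond L n m, bond L n m + 1} := by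
  classical
  ext c c'
  simp only [Pi.add_apply, Pi.smul_apply, smul_eq_mul, Pi.one_apply, mul_one]
  rw [agree_pair_eq_bondAgree, layerMean_agree hq, Finset.prod_eq_single m]
  · rcases hj with rfl | rfl
    · simp [site_one_ne_zero]
    · simp [site_one_ne_zero]
  · intro m' _ hm
    have h1 := bond_disjoint n m' m hm
    have h2 := bond_disjoint n m m' hm.symm
    rcases hj with rfl | rfl
    · simp [h1.1, h2.2.symm]
    · simp [h1.1, h1.2]
  · simp

/-- A function of the values of both copies at one site, zero where they agree, is averaged like
the disagreement indicator. -/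
lemma layerMean_site (hq : 2 ≤ q) (n : ℕ) (m : Fin L) (j : Site L)
    (hj : j = bond L n m ∨ j = bond L n m + 1) (H : Fin q → Fin q → ℂ) (h0 : ∀ r, H r r = 0) :
    layerMean n (fun c c' : Config q L => H (c j) (c' j)) =
      ((∑ r, ∑ s, H r s) / ((q : ℂ) ^ 2 - 1)) •
        (1 + (-1 : ℂ) • agree {bond L n m, bond L n m + 1}) := by
  ext c c'
  simp only [Pi.add_apply, Pi.smul_apply, smul_eq_mul, Pi.one_apply]
  rw [agree_pair_eq_bondAgree, bondAgree]
  have key : ∀ F : Fin q × Fin q → Fin q × Fin q → ℂ,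
      layerMean n (fun d d' : Config q L => F (d (bond L n m), d (bond L n m + 1))
        (d' (bond L n m), d' (bond L n m + 1))) c c' =
      mean fun u : Gate q => F (u (c (bond L n m), c (bond L n m + 1)))
        (u (c' (bond L n m), c' (bond L n m + 1))) := by
    intro F
    have := layerMean_prod n c c' fun m' p p' => if m' = m then F p p' else 1
    simp only [Finset.prod_ite_eq', Finset.mem_univ, if_true] at this
    rw [this, Finset.prod_eq_single m]
    · simp
    · intro m' _ hm; simp only [hm, if_false]; exact mean_const _
    · simp
  rcases hj with rfl | rfl
  · rw [key fun p p' => H p.1 p'.1, mean_gate_fst hq H h0]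
    split_ifs <;> simp
  · rw [key fun p p' => H p.2 p'.2, mean_gate_snd hq H h0]
    split_ifs <;> simp

end chain
section chain
variable {q L : ℕ} [NeZero L]
set_option linter.unusedSectionVars false

/-! ### Two copies that differ at one site only -/

lemma layerMap_perm (n : ℕ) (σ : Site L → Equiv.Perm (Fin q)) (u : Fin L → Gate q)
    (c : Config q L) : layerMap n u (fun k => σ k (c k)) =
      layerMap n (fun m => u m * Equiv.prodCongr (σ (bond L n m)) (σ (bond L n m + 1))) c := by
  funext k
  obtain ⟨m, hk⟩ := exists_bond n k
  have h1 := layerMap_apply n u (fun k => σ k (c k)) m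
  have h2 := layerMap_apply n
    (fun m => u m * Equiv.prodCongr (σ (bond L n m)) (σ (bond L n m + 1))) c m
  have h3 := h1.trans h2.symm
  rw [Prod.mk.injEq] at h3
  rcases hk with rfl | rfl
  · exact h3.1
  · exact h3.2

/-- Right multiplication by a fixed permutation preserves the uniform measure on gates, so one layer
already makes an arbitrary `φ` invariant under sitewise relabelling. -/
lemma layerMean_perm (n : ℕ) (φ : Config q L → Config q L → ℂ)
    (σ : Site L → Equiv.Perm (Fin q)) (c c' : Config q L) :
    layerMean n φ (fun k => σ k (c k)) (fun k => σ k (c' k)) = layerMean n φ c c' := by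
  simp only [layerMean, layerMap_perm]
  exact mean_equiv (Equiv.piCongrRight fun m => Equiv.mulRight
    (Equiv.prodCongr (σ (bond L n m)) (σ (bond L n m + 1)) : Gate q))
    fun u => φ (layerMap n u c) (layerMap n u c')

lemma evolMean_perm (n : ℕ) (φ : Config q L → Config q L → ℂ)
    (hφ : ∀ (σ : Site L → Equiv.Perm (Fin q)) (c c' : Config q L),
      φ (fun k => σ k (c k)) (fun k => σ k (c' k)) = φ c c')
    (σ : Site L → Equiv.Perm (Fin q)) (c c' : Config q L) :
    evolMean n φ (fun k => σ k (c k)) (fun k => σ k (c' k)) = evolMean n φ c c' := by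
  induction n generalizing φ with
  | zero => rw [evolMean_zero, hφ]
  | succ n ih => rw [evolMean_succ]; exact ih _ (layerMean_perm n φ)

lemma agree_perm (S : Set (Site L)) (σ : Site L → Equiv.Perm (Fin q)) (c c' : Config q L) :
    agree S (fun k => σ k (c k)) (fun k => σ k (c' k)) = agree S c c' := by
  classical
  rw [agree, agree]
  exact if_congr (by simp) rfl rfl

/-- A sitewise relabelling carries one pair of copies to the other: at site 0 it must match two
distinct values at once, elsewhere a swap is enough. -/
lemma evolMean_agree_update (n : ℕ) (S : Set (Site L)) (c d : Config q L) (s r : Fin q)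
    (hs : s ≠ c 0) (hr : r ≠ d 0) :
    evolMean n (agree S) c (Function.update c 0 s) =
      evolMean n (agree S) d (Function.update d 0 r) := by
  obtain ⟨τ, h1, h2⟩ := exists_perm_pair hs hr
  have e1 : d = fun k =>
      (if k = 0 then τ else Equiv.swap (c k) (d k) : Equiv.Perm (Fin q)) (c k) := by
    funext k
    by_cases hk : k = 0
    · simp [hk, h2]
    · simp [hk]
  have e2 : Function.update d 0 r = fun k =>
      (if k = 0 then τ else Equiv.swap (c k) (d k) : Equiv.Perm (Fin q))
        (Function.update c 0 s k) := by
    funext k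
    by_cases hk : k = 0
    · simp [hk, h1]
    · simp [hk]
  rw [e2]
  conv_rhs => enter [3]; rw [e1]
  exact (evolMean_perm n _ (agree_perm S) _ _ _).symm

lemma exists_evolMean_agree (hq : 2 ≤ q) (n : ℕ) (S : Set (Site L)) :
    ∃ w : ℂ, ∀ (c : Config q L) (s : Fin q), s ≠ c 0 →
      evolMean n (agree S) c (Function.update c 0 s) = w :=
  ⟨evolMean n (agree S) (fun _ => ⟨0, by omega⟩)
    (Function.update (fun _ => ⟨0, by omega⟩) 0 ⟨1, by omega⟩),
    fun c s hs => evolMean_agree_update n S c _ s _ hs (by simp)⟩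

lemma agree_self (S : Set (Site L)) (c : Config q L) : agree S c c = 1 := by simp [agree]

lemma evolMean_agree_self (n : ℕ) (S : Set (Site L)) (c : Config q L) :
    evolMean n (agree S) c c = 1 := by
  simp only [evolMean, agree_self]
  exact mean_const _

/-- The probability that the perturbation has reached an interval, as a determinant of two
biased walks. -/
lemma evolMean_agree_interval (hq : 2 ≤ q) (n : ℕ) : ∀ (l r : ℤ) (k : ℕ), r = l + 2 * k →
    Even (l + n) → k + n ≤ L → -(2 * L : ℤ) < l - n → r + n ≤ 2 * L →
    ∀ (c : Config q L) (s : Fin q), s ≠ c 0 →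
    evolMean n (agree (interval l (2 * k))) c (Function.update c 0 s) =
      1 - (walk q n l * walk q n (2 - r) -
        ((q : ℂ) ^ (2 * k))⁻¹ * walk q n (2 - l) * walk q n r) := by
  obtain ⟨n0, n1, n2⟩ := natCast_ne hq
  have empty : ∀ (l : ℤ), (interval l (2 * 0) : Set (Site L)) = ∅ := fun l => by
    ext z; simp [interval]
  induction n with
  | zero =>
    intro l r k hr hl hk h1 h2 c s hs
    rw [evolMean_zero]
    rw [Nat.cast_zero, add_zero, Int.even_iff] at hl
    have hmem : (∀ z ∈ interval l (2 * k), c z = Function.update c 0 s z) ↔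
        (0 : Site L) ∉ interval l (2 * k) := by
      constructor
      · intro h h0
        exact hs (by simpa using (h 0 h0).symm)
      · intro h z hz
        rw [Function.update_of_ne]
        rintro rfl; exact h hz
    have hoff : (offset (l : Site L) 0 : ℤ) = -l % (2 * L) := by
      rw [offset, zero_sub, ← Int.cast_neg, ZMod.val_intCast]
      push_cast; rfl
    have hin : (0 : Site L) ∈ interval l (2 * k) ↔ l ≤ 0 ∧ 2 - r ≤ 0 := by
      -- Here `l` and `r` are even, so an interval that ends beyond site 0 has `r ≥ 2`. If `l > 0`,
      -- the offset of site 0 is `2L - l`, and `r ≤ 2L` keeps the interval from reaching its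
      -- periodic image.
      rw [interval, Set.mem_ofPred_eq]
      push_cast at *
      by_cases hl0 : l ≤ 0
      · rw [Int.emod_eq_of_lt (by omega) (by omega)] at hoff
        omega
      · by_cases hk0 : k = 0
        · omega
        · have : -l % (2 * L : ℤ) = 2 * L - l := by
            rw [← Int.add_emod_right, Int.emod_eq_of_lt (by omega) (by omega)]; ring
          omega
    -- The exchanged term would need `l ≥ 2` and `r ≤ 0`, contrary to `l ≤ r`.
    have hz : walk q 0 (2 - l) * walk q 0 r = 0 := by
      rw [walk, walk]
      split_ifs <;> first | omega | simp
    rw [mul_assoc, hz, mul_zero, sub_zero, agree, walk, walk]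
    simp only [hmem, hin]
    by_cases ha : l ≤ 0 <;> by_cases hb : 2 - r ≤ 0 <;> simp only [ha, hb] <;> simp
  | succ n ih =>
    intro l r k hr hl hk h1 h2 c s hs
    push_cast at h1 h2 hl
    rcases k with _ | k
    · rw [empty, agree_empty, evolMean_one]
      have : r = l := by simpa using hr
      subst this
      simp
      ring
    · rw [evolMean_succ]
      have hlay := layerMean_agree_interval (q := q) (L := L) hq n (l - 1) k
        (by rw [Int.even_iff] at *; omega) (by omega)
      rw [sub_add_cancel, show l - 1 + 2 = l + 1 by ring] at hlay
      rw [show 2 * (k + 1) = 2 * k + 2 by ring, hlay]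
      simp only [evolMean_smul, evolMean_add, Pi.add_apply, Pi.smul_apply, smul_eq_mul]
      rw [Int.even_iff] at hl
      push_cast at hr
      rw [show 2 * k + 4 = 2 * (k + 2) by ring, show 2 * k + 2 = 2 * (k + 1) by ring,
        ih (l - 1) (r + 1) (k + 2) (by push_cast; omega) (by rw [Int.even_iff]; omega) (by omega)
          (by omega) (by omega) c s hs,
        ih (l - 1) (r - 1) (k + 1) (by push_cast; omega) (by rw [Int.even_iff]; omega) (by omega)
          (by omega) (by omega) c s hs,
        ih (l + 1) (r + 1) (k + 1) (by push_cast; omega) (by rw [Int.even_iff]; omega) (by omega)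
          (by omega) (by omega) c s hs,
        ih (l + 1) (r - 1) k (by omega) (by rw [Int.even_iff]; omega) (by omega)
          (by omega) (by omega) c s hs]
      -- Each outward step of an end multiplies the weight of the exchanged term by `q⁻¹`, each
      -- inward step by `q`. This interchanges the two step probabilities, as the reflected
      -- arguments `2 - l` and `r` require.
      rw [show 2 - (r + 1) = 2 - r - 1 by ring, show 2 - (r - 1) = 2 - r + 1 by ring,
        show 2 - (l - 1) = 2 - l + 1 by ring, show 2 - (l + 1) = 2 - l - 1 by ring]
      simp only [walk]
      field_simp
      ring

/-- The agreement probability at a site covered by the last gates. -/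
lemma evolMean_agree_site (hq : 2 ≤ q) (x : ℤ) (t : ℕ) (ht : 0 < t) (htL : 2 * t ≤ L)
    (h1 : -(L : ℤ) < 2 * x) (h2 : 2 * x ≤ L) (c : Config q L) (s : Fin q) (hs : s ≠ c 0) :
    evolMean (2 * t) (agree {((2 * x : ℤ) : Site L)}) c (Function.update c 0 s) =
      1 - (walk q (2 * t - 1) (2 * x - 1) * walk q (2 * t) (2 - 2 * x) -
        (q : ℂ)⁻¹ * walk q (2 * t - 1) (3 - 2 * x) * walk q (2 * t) (2 * x)) := by
  obtain ⟨n0, n1, n2⟩ := natCast_ne hq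
  obtain ⟨n, hn⟩ : ∃ n, 2 * t = n + 1 := ⟨2 * t - 1, by omega⟩
  have hev : Even (2 * x - 1 + n) := by rw [Int.even_iff]; omega
  rw [hn, Nat.add_sub_cancel, evolMean_succ]
  obtain ⟨m, hm⟩ := exists_bond_eq (L := L) n (2 * x - 1) hev (v := 0) (by simp) (by omega)
  have hb : bond L n m = ((2 * x - 1 : ℤ) : Site L) := by
    have := add_offset ((2 * x - 1 : ℤ) : Site L) (bond L n m)
    rw [hm, Nat.cast_zero, add_zero] at this
    exact this.symm
  have hj : ((2 * x : ℤ) : Site L) = bond L n m + 1 := by rw [hb]; push_cast; ring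
  rw [layerMean_agree_singleton hq n m _ (Or.inr hj)]
  have hint : ({bond L n m, bond L n m + 1} : Set (Site L)) = interval (2 * x - 1) (2 * 1) := by
    ext z
    rw [interval, Set.mem_ofPred_eq, ← hb]
    have hlt := offset_lt (bond L n m) z
    constructor
    · rintro (rfl | rfl)
      · have := offset_add (bond L n m) (v := 0) (by omega)
        simp at this; omega
      · have := offset_add (bond L n m) (v := 1) (by omega)
        rw [Nat.cast_one] at this; omega
    · intro h
      have h3 := add_offset (bond L n m) z
      obtain h4 | h4 : offset (bond L n m) z = 0 ∨ offset (bond L n m) z = 1 := by omega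
      · left; rw [← h3, h4]; simp
      · right; rw [Set.mem_singleton_iff, ← h3, h4]; simp
  rw [hint]
  simp only [evolMean_smul, evolMean_add, evolMean_one, Pi.add_apply, Pi.smul_apply, smul_eq_mul,
    Pi.one_apply]
  rw [evolMean_agree_interval hq n (2 * x - 1) (2 * x + 1) 1 (by push_cast; ring) hev (by omega)
    (by omega) (by omega) c s hs]
  rw [show (2 : ℤ) - (2 * x + 1) = 2 - 2 * x - 1 by ring,
    show (2 : ℤ) - (2 * x - 1) = 3 - 2 * x by ring]
  -- Expanding the walks of length `2 * t` by one step produces two mixed products, which cancel.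
  -- What remains is the determinant of the bond interval times the `q / (q + 1)` of the last gate.
  simp only [walk]
  rw [show (2 : ℤ) - 2 * x + 1 = 3 - 2 * x by ring]
  field_simp
  ring

/-- Both sites are legs of the same gate in the last layer, and the averaged gate treats its two
output legs alike. -/
lemma evolMean_agree_half (hq : 2 ≤ q) (x : ℤ) (t : ℕ) (ht : 0 < t) :
    evolMean (2 * t) (agree {((2 * x - 1 : ℤ) : Site L)} : Config q L → Config q L → ℂ) =
      evolMean (2 * t) (agree {((2 * x : ℤ) : Site L)}) := by
  obtain ⟨n, hn⟩ : ∃ n, 2 * t = n + 1 := ⟨2 * t - 1, by omega⟩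
  have hev : Even (2 * x - 1 + n) := by rw [Int.even_iff]; omega
  rw [hn, evolMean_succ, evolMean_succ]
  obtain ⟨m, hm⟩ := exists_bond_eq (L := L) n (2 * x - 1) hev (v := 0) (by simp)
    (by have := NeZero.pos L; omega)
  have hb : bond L n m = ((2 * x - 1 : ℤ) : Site L) := by
    have := add_offset ((2 * x - 1 : ℤ) : Site L) (bond L n m)
    rw [hm, Nat.cast_zero, add_zero] at this
    exact this.symm
  have hj : ((2 * x : ℤ) : Site L) = bond L n m + 1 := by rw [hb]; push_cast; ring
  rw [layerMean_agree_singleton hq n m _ (Or.inr hj),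
    layerMean_agree_singleton hq n m _ (Or.inl hb.symm)]

end chain
section chain
variable {q L : ℕ} [NeZero L]
set_option linter.unusedSectionVars false

/-! ### Matrix elements -/

lemma siteOp_apply (j : Site L) (a : Matrix (Fin q) (Fin q) ℂ) (c' c : Config q L) :
    open Classical in siteOp j a c' c = if c' = Function.update c j (c' j) then a (c' j) (c j) else 0 := by
  classical
  rw [siteOp, tensorOp, Matrix.of_apply,
    ← Finset.mul_prod_erase _ _ (Finset.mem_univ j), Function.update_self]
  split_ifs with h
  · rw [Finset.prod_eq_one, mul_one]
    intro k hk
    have hk := Finset.ne_of_mem_erase hk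
    rw [Function.update_of_ne hk, h, Function.update_of_ne hk, Matrix.one_apply_eq]
  · obtain ⟨k, hk⟩ : ∃ k, c' k ≠ Function.update c j (c' j) k := by
      by_contra! hall; exact h (funext hall)
    have hkj : k ≠ j := by rintro rfl; simp at hk
    rw [Function.update_of_ne hkj] at hk
    rw [Finset.prod_eq_zero (Finset.mem_erase.2 ⟨hkj, Finset.mem_univ k⟩), mul_zero]
    rw [Function.update_of_ne hkj, Matrix.one_apply_ne hk]

lemma sum_siteOp_mul (j : Site L) (a : Matrix (Fin q) (Fin q) ℂ) (c : Config q L)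
    (X : Config q L → ℂ) :
    ∑ c', siteOp j a c' c * X c' = ∑ s, a s (c j) * X (Function.update c j s) := by
  classical
  rw [← Finset.sum_fiberwise_of_maps_to (g := fun c' : Config q L => c' j)
    (t := Finset.univ) (fun _ _ => Finset.mem_univ _)]
  refine Finset.sum_congr rfl fun s _ => ?_
  rw [Finset.sum_eq_single (Function.update c j s)]
  · rw [siteOp_apply]; simp
  · intro c' hc' hne
    rw [siteOp_apply, if_neg, zero_mul]
    rw [Finset.mem_filter] at hc'
    rw [hc'.2]; exact hne
  · simp

lemma flat_mul_star (hq : 2 ≤ q) (r s : Fin q) : flat q r * star (flat q s) = (q : ℂ)⁻¹ := by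
  simp only [flat, star_inv₀, Complex.star_def, Complex.conj_ofReal]
  rw [← mul_inv, ← Complex.ofReal_mul, Real.mul_self_sqrt (by positivity)]
  simp

lemma agreeOp_apply (hq : 2 ≤ q) (j : Site L) (c' c : Config q L) :
    agreeOp j c' c = agree {j} c' c := by
  obtain ⟨n0, n1, n2⟩ := natCast_ne hq
  rw [agreeOp, Matrix.smul_apply, tensorOp, Matrix.of_apply,
    ← Finset.mul_prod_erase _ _ (Finset.mem_univ j), Function.update_self]
  have : ∏ k ∈ Finset.univ.erase j, Function.update
      (fun _ => vecMulVec (flat q) (star (flat q))) j 1 k (c' k) (c k) =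
      ((q : ℂ)⁻¹) ^ (2 * L - 1) := by
    rw [Finset.prod_congr rfl (g := fun _ => (q : ℂ)⁻¹), Finset.prod_const,
      Finset.card_erase_of_mem (Finset.mem_univ _), Finset.card_univ, ZMod.card]
    intro k hk
    rw [Function.update_of_ne (Finset.ne_of_mem_erase hk), vecMulVec_apply, Pi.star_apply,
      flat_mul_star hq]
  rw [this, smul_eq_mul, mul_left_comm, ← mul_pow, mul_inv_cancel₀ n0, one_pow, mul_one,
    Matrix.one_apply]
  simp [agree]

lemma conj_mapOp_apply (E : Config q L → Config q L) (X : ChainOp q L) (c' c : Config q L) :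
    ((mapOp E)ᴴ * X * mapOp E) c' c = X (E c') (E c) := by
  simp [mapOp, Matrix.mul_apply, apply_ite]

/-- Each value at site 0 occurs in `q^(2L-1)` configurations; the extra factor `q` on the left
avoids the subtraction in the exponent. -/
lemma sum_site (F : Fin q → ℂ) :
    (q : ℂ) * ∑ c : Config q L, F (c 0) = (q : ℂ) ^ (2 * L) * ∑ r, F r := by
  have h : ∀ c : Config q L, F (c 0) = ∏ k, (if k = 0 then F else 1) (c k) := by
    intro c
    rw [Finset.prod_eq_single 0]
    · simp
    · intro k _ hk; simp [hk]
    · simp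
  simp only [h]
  have := Finset.prod_univ_sum (fun _ : Site L => (Finset.univ : Finset (Fin q)))
    fun k r => (if k = 0 then F else 1) r
  rw [Fintype.piFinset_univ] at this
  rw [← this, ← Finset.mul_prod_erase _ _ (Finset.mem_univ 0),
    Finset.prod_congr rfl (g := fun _ => (q : ℂ)), Finset.prod_const,
    Finset.card_erase_of_mem (Finset.mem_univ _), Finset.card_univ, ZMod.card]
  · have : 2 * L = 2 * L - 1 + 1 := by have := NeZero.pos L; omega
    conv_rhs => rw [this, pow_succ]
    simp; ring
  · intro k hk
    simp [Finset.ne_of_mem_erase hk]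

/-! ### The decorrelator -/

lemma decorrelator_eq (hq : 2 ≤ q) {t : ℕ} (a : Matrix (Fin q) (Fin q) ℂ) (j : Site L)
    (g : Circuit q L t) :
    decorrelator a j g = 1 - 1 / (q : ℂ) ^ (2 * L) * ∑ c, ∑ s, a s (c 0) *
      agree {j} (evolMap (2 * t) g c) (evolMap (2 * t) g (Function.update c 0 s)) := by
  rw [decorrelator, timeEvolution, evolution_eq_mapOp]
  congr 2
  set P : ChainOp q L := mapOp (evolMap (2 * t) g)
  have : (agreeOp j * (P * siteOp 0 a * Pᴴ)).trace = (Pᴴ * agreeOp j * P * siteOp 0 a).trace := by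
    rw [← Matrix.mul_assoc, Matrix.trace_mul_comm]
    simp only [Matrix.mul_assoc]
  rw [this, Matrix.trace]
  refine Finset.sum_congr rfl fun c _ => ?_
  rw [Matrix.diag_apply, Matrix.mul_apply]
  have h := sum_siteOp_mul 0 a c fun c' =>
    agree {j} (evolMap (2 * t) g c) (evolMap (2 * t) g c')
  rw [← h]
  refine Finset.sum_congr rfl fun c' _ => ?_
  rw [conj_mapOp_apply, agreeOp_apply hq, mul_comm]

lemma IsPerturbation.sum_col (hq : 2 ≤ q) {a : Matrix (Fin q) (Fin q) ℂ} (ha : IsPerturbation a)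
    (r : Fin q) : ∑ s, a s r = 1 := by
  have h := congrFun ha.conserving r
  have hf : star (flat q) r ≠ 0 := by
    have := flat_mul_star hq r r
    intro h0
    rw [Pi.star_apply] at h0
    rw [h0, mul_zero] at this
    exact inv_ne_zero (natCast_ne hq).1 this.symm
  have : star (flat q) r * ∑ s, a s r = star (flat q) r * 1 := by
    rw [mul_one, Finset.mul_sum]; exact h
  exact mul_left_cancel₀ hf this

/-- The averaged decorrelator is the probability that two copies differing at the site `0` only
differ at `j` later on. -/
lemma avgDecorrelator_eq (hq : 2 ≤ q) {a : Matrix (Fin q) (Fin q) ℂ} (ha : IsPerturbation a)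
    (j : Site L) (t : ℕ) (w : ℂ) (hw : ∀ (c : Config q L) (s : Fin q), s ≠ c 0 →
      evolMean (2 * t) (agree {j}) c (Function.update c 0 s) = w) :
    avgDecorrelator a j t = 1 - w := by
  obtain ⟨n0, n1, n2⟩ := natCast_ne hq
  have h1 : avgDecorrelator a j t = 1 - 1 / (q : ℂ) ^ (2 * L) * ∑ c : Config q L, ∑ s,
      a s (c 0) * evolMean (2 * t) (agree {j}) c (Function.update c 0 s) := by
    have : avgDecorrelator a j t = mean fun g : Circuit q L t => decorrelator a j g := rfl
    rw [this]
    simp only [decorrelator_eq hq, mean_sub, mean_mul_left, mean_sum, mean_const, evolMean]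
  -- The terms with `s ≠ c 0` have agreement probability `w`, the diagonal term has probability 1.
  -- The excess `1 - w` multiplies a diagonal entry and drops out by tracelessness in `h3`.
  have h2 : ∀ c : Config q L, ∑ s, a s (c 0) *
      evolMean (2 * t) (agree {j}) c (Function.update c 0 s) = w + (1 - w) * a (c 0) (c 0) := by
    intro c
    have : ∀ s, a s (c 0) * evolMean (2 * t) (agree {j}) c (Function.update c 0 s) =
        a s (c 0) * w + if s = c 0 then a (c 0) (c 0) * (1 - w) else 0 := by
      intro s
      split_ifs with hs
      · subst hs
        rw [Function.update_eq_self, evolMean_agree_self]; ring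
      · rw [hw c s hs, add_zero]
    simp only [this, Finset.sum_add_distrib, ← Finset.sum_mul, ha.sum_col hq]
    simp; ring
  have h3 : ∑ c : Config q L, a (c 0) (c 0) = 0 := by
    have := sum_site (L := L) fun r => a r r
    have htr : ∑ r, a r r = 0 := ha.traceless
    rw [htr, mul_zero] at this
    exact (mul_eq_zero.1 this).resolve_left n0
  rw [h1]
  simp only [h2, Finset.sum_add_distrib, ← Finset.mul_sum, h3]
  simp
  field_simp

/-! ### The out-of-time-order correlator -/

lemma siteOp_diag (j : Site L) {d : Matrix (Fin q) (Fin q) ℂ} (hd : d.IsDiag) :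
    siteOp j d = Matrix.diagonal fun c : Config q L => d (c j) (c j) := by
  ext c' c
  rw [siteOp_apply]
  by_cases h : c' = c
  · subst h; simp
  · rw [Matrix.diagonal_apply_ne _ h]
    split_ifs with h'
    · exact hd fun e => h (by rw [h', e, Function.update_eq_self])
    · rfl

/-- The evolved `d` stays diagonal because the circuit permutes basis states, so commuting with it
multiplies each matrix element by a difference of diagonal entries. These are real by Hermiticity,
hence a plain square. -/
lemma otoc_eq {t : ℕ} {d : Matrix (Fin q) (Fin q) ℂ} (hd : IsObservable d)
    (hdd : d.IsDiag) (b : Matrix (Fin q) (Fin q) ℂ) (j : Site L) (g : Circuit q L t) :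
    otoc d b j g = 1 / 2 * (1 / (q : ℂ) ^ (2 * L)) * ∑ c : Config q L, ∑ s,
      (b s (c 0) * star (b s (c 0))) * (fun c c' : Config q L =>
        (d (c j) (c j) - d (c' j) (c' j)) ^ 2) (evolMap (2 * t) g c)
          (evolMap (2 * t) g (Function.update c 0 s)) := by
  set E := evolMap (2 * t) g with hE
  have hinj : Function.Injective E := evolMap_injective _ _
  have hh : heisenberg d j g = Matrix.diagonal fun c : Config q L => d (E c j) (E c j) := by
    ext c' c
    rw [heisenberg, timeEvolution, evolution_eq_mapOp, conj_mapOp_apply, siteOp_diag j hdd]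
    by_cases h : c' = c
    · subst h; simp [hE]
    · rw [Matrix.diagonal_apply_ne _ h, Matrix.diagonal_apply_ne _ (hinj.ne h)]
  have hc : ∀ c' c, commutator (heisenberg d j g) (siteOp 0 b) c' c =
      (d (E c' j) (E c' j) - d (E c j) (E c j)) * siteOp 0 b c' c := by
    intro c' c
    rw [commutator, hh, Matrix.sub_apply, Matrix.diagonal_mul, Matrix.mul_diagonal]; ring
  have hreal : ∀ r, star (d r r) = d r r := fun r => hd.hermitian.apply r r
  have hb : ∀ c' c : Config q L, siteOp 0 b c' c * star (siteOp 0 b c' c) =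
      siteOp 0 (Matrix.of fun s r => b s r * star (b s r)) c' c := by
    intro c' c
    rw [siteOp_apply, siteOp_apply]
    split_ifs <;> simp
  have htr : (1 : ChainOp q L).trace = (q : ℂ) ^ (2 * L) := by
    simp
  rw [otoc, htr, mul_div_assoc, mul_assoc (1 / 2 : ℂ)]
  congr 1
  rw [div_eq_mul_one_div, mul_comm]
  congr 1
  rw [Matrix.trace]
  simp only [Matrix.diag_apply, Matrix.mul_apply, Matrix.conjTranspose_apply, hc]
  rw [Finset.sum_comm]
  refine Finset.sum_congr rfl fun c _ => ?_
  have h := sum_siteOp_mul 0 (Matrix.of fun s r => b s r * star (b s r)) c fun c' =>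
    (d (E c j) (E c j) - d (E c' j) (E c' j)) ^ 2
  refine Eq.trans (Finset.sum_congr rfl fun c' _ => ?_) h
  rw [← hb, star_mul', star_sub, hreal, hreal]
  ring

lemma sum_observable_diff {d : Matrix (Fin q) (Fin q) ℂ} (hd : IsObservable d)
    (hdd : d.IsDiag) : ∑ r, ∑ s, (d r r - d s s) ^ 2 = 2 * (q : ℂ) ^ 2 := by
  have h1 : ∑ r, d r r = 0 := hd.traceless
  have h2 : ∑ r, d r r ^ 2 = q := by
    rw [← hd.normalised, Matrix.trace]
    refine Finset.sum_congr rfl fun r _ => ?_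
    rw [Matrix.diag_apply, Matrix.mul_apply, Finset.sum_eq_single r]
    · rw [hd.hermitian, sq]
    · intro s _ hs
      rw [hdd hs.symm, zero_mul]
    · simp
  have : ∀ r s, (d r r - d s s) ^ 2 = d r r ^ 2 - 2 * (d r r * d s s) + d s s ^ 2 := by
    intro r s; ring
  simp only [this, Finset.sum_add_distrib, Finset.sum_sub_distrib, ← Finset.mul_sum, h1, h2]
  simp [← Finset.mul_sum, h2]
  ring

lemma sum_offDiag_observable {b : Matrix (Fin q) (Fin q) ℂ} (hb : IsObservable b) :
    ∑ r, ∑ s, (if s = r then 0 else b s r * star (b s r)) = q - ∑ r, b r r ^ 2 := by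
  have h1 : ∀ r s, (if s = r then 0 else b s r * star (b s r)) =
      b s r * star (b s r) - if s = r then b r r ^ 2 else 0 := by
    intro r s
    split_ifs with h
    · subst h
      rw [show star (b s s) = b s s from hb.hermitian.apply s s]; ring
    · simp
  simp only [h1, Finset.sum_sub_distrib]
  congr 1
  · rw [Finset.sum_comm, ← hb.normalised, Matrix.trace]
    simp only [Matrix.diag_apply, Matrix.mul_apply, Matrix.conjTranspose_apply]
  · simp

/-- The last layer reduces both sides to disagreement on the bond that contains `j`. The constant is
the ratio of `2q² / (q² - 1)` to the disagreement weight `q / (q + 1)`. -/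
lemma evolMean_observable (hq : 2 ≤ q) {d : Matrix (Fin q) (Fin q) ℂ} (hd : IsObservable d)
    (hdd : d.IsDiag) (j : Site L) (t : ℕ) (ht : 0 < t) :
    evolMean (2 * t) (fun c c' : Config q L => (d (c j) (c j) - d (c' j) (c' j)) ^ 2) =
      (2 * (q : ℂ) / (q - 1)) • (1 + (-1 : ℂ) • evolMean (2 * t) (agree {j})) := by
  obtain ⟨n0, n1, n2⟩ := natCast_ne hq
  obtain ⟨n, hn⟩ : ∃ n, 2 * t = n + 1 := ⟨2 * t - 1, by omega⟩
  obtain ⟨m, hm⟩ := exists_bond n j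
  rw [hn, evolMean_succ, evolMean_succ, layerMean_agree_singleton hq n m j hm,
    layerMean_site hq n m j hm (fun r s => (d r r - d s s) ^ 2) (by simp),
    sum_observable_diff hd hdd]
  ext c c'
  simp only [evolMean_smul, evolMean_add, evolMean_one, Pi.add_apply, Pi.smul_apply, smul_eq_mul,
    Pi.one_apply]
  have : (q : ℂ) ^ 2 - 1 = (q + 1) * (q - 1) := by ring
  rw [this]
  field_simp
  ring

lemma avgOtoc_eq (hq : 2 ≤ q) {d b : Matrix (Fin q) (Fin q) ℂ} (hd : IsObservable d)
    (hdd : d.IsDiag) (hb : IsObservable b) (j : Site L) (t : ℕ) (ht : 0 < t) (w : ℂ)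
    (hw : ∀ (c : Config q L) (s : Fin q), s ≠ c 0 →
      evolMean (2 * t) (agree {j}) c (Function.update c 0 s) = w) :
    avgOtoc d b j t = (q : ℂ) / (q - 1) * (1 - diagWeight b) * (1 - w) := by
  obtain ⟨n0, n1, n2⟩ := natCast_ne hq
  have h1 : avgOtoc d b j t = 1 / 2 * (1 / (q : ℂ) ^ (2 * L)) * ∑ c : Config q L, ∑ s,
      (b s (c 0) * star (b s (c 0))) * evolMean (2 * t) (fun c c' : Config q L =>
        (d (c j) (c j) - d (c' j) (c' j)) ^ 2) c (Function.update c 0 s) := by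
    have : avgOtoc d b j t = mean fun g : Circuit q L t => otoc d b j g := rfl
    rw [this]
    simp only [otoc_eq hd hdd, mean_mul_left, mean_sum]
    rfl
  have h2 : ∀ c : Config q L, ∑ s, (b s (c 0) * star (b s (c 0))) *
      evolMean (2 * t) (fun c c' : Config q L =>
        (d (c j) (c j) - d (c' j) (c' j)) ^ 2) c (Function.update c 0 s) =
      (2 * (q : ℂ) / (q - 1) * (1 - w)) *
        (fun r => ∑ s, if s = r then 0 else b s r * star (b s r)) (c 0) := by
    intro c
    rw [Finset.mul_sum]
    refine Finset.sum_congr rfl fun s _ => ?_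
    rw [evolMean_observable hq hd hdd j t ht]
    simp only [Pi.add_apply, Pi.smul_apply, smul_eq_mul, Pi.one_apply]
    split_ifs with hs
    · subst hs
      rw [Function.update_eq_self, evolMean_agree_self]; ring
    · rw [hw c s hs]; ring
  have h3 := sum_site (L := L) fun r => ∑ s, if s = r then 0 else b s r * star (b s r)
  rw [sum_offDiag_observable hb] at h3
  rw [h1]
  simp only [h2]
  rw [← Finset.mul_sum]
  have h4 : ∑ c : Config q L, (fun r => ∑ s, if s = r then 0 else b s r * star (b s r)) (c 0) =
      (q : ℂ) ^ (2 * L) * (q - ∑ r, b r r ^ 2) / q := by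
    rw [eq_div_iff n0, mul_comm]; exact h3
  rw [h4, diagWeight]
  field_simp

end chain
/-! ### The polynomials `A` as rescaled walk probabilities -/

/-- The bound on `X + Y` removes the Kronecker deltas from all three terms. The summand `s = Y` has
coefficient 1 on both sides; Pascal's rule handles the others. -/
lemma A_pascal (X Y : ℤ) (z : ℂ) (h : 2 ≤ X + Y) : A X Y z = A X (Y - 1) z + A (X - 1) Y z := by
  rw [A, A, A, if_neg (by omega), if_neg (by omega), if_neg (by omega), add_zero, add_zero,
    add_zero]
  rcases le_or_gt Y 0 with hY | hY
  · rw [Finset.Icc_eq_empty (by omega), Finset.Icc_eq_empty (by omega)]; simp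
  have hI : Finset.Icc 1 Y = insert Y (Finset.Icc 1 (Y - 1)) := by
    ext s; simp only [Finset.mem_insert, Finset.mem_Icc]; omega
  have hn : Y ∉ Finset.Icc 1 (Y - 1) := by simp
  rw [hI, Finset.sum_insert hn, Finset.sum_insert hn, add_left_comm, ← Finset.sum_add_distrib]
  congr 1
  · simp
  · refine Finset.sum_congr rfl fun s hs => ?_
    rw [Finset.mem_Icc] at hs
    rw [← add_mul, ← Int.cast_add]
    congr 2
    obtain ⟨k, hk⟩ : ∃ k : ℕ, Y - 1 - s = k := ⟨(Y - 1 - s).toNat, by omega⟩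
    have e1 : (Y - s).toNat = k + 1 := by omega
    have e2 : (Y - 1 - s).toNat = k := by omega
    rw [e1, e2, show X - 1 + Y - s = (X - 1 + (Y - 1) - s) + 1 by ring,
      show X - 1 - 1 + Y - s = X - 1 + (Y - 1) - s by ring]
    exact Ring.choose_succ_succ _ _

/-- With a negative upper entry the binomial coefficients become signed ordinary ones, and the sum
is a binomial expansion. It supplies the initial line `X + Y = 1` of the recursion. -/
lemma A_of_add_eq_one (m : ℕ) (z : ℂ) : A (-m) (m + 1) z = z * (z - 1) ^ m := by
  rw [A, if_neg (by omega), add_zero, sub_eq_add_neg z 1, add_pow, Finset.mul_sum]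
  refine (Finset.sum_nbij (fun i : ℕ => (i : ℤ) + 1) ?_ ?_ ?_ ?_).symm
  · intro i hi; simp at hi ⊢; omega
  · intro i _ j _ h; simpa using h
  · intro s hs
    simp only [Finset.coe_Icc, Set.mem_Icc] at hs
    refine ⟨(s - 1).toNat, by simp; omega, by simp; omega⟩
  · intro i hi
    have hi : i ≤ m := by simp at hi; omega
    rw [show -(m : ℤ) - 1 + (m + 1) - (i + 1) = -((i : ℤ) + 1) by ring,
      show ((m : ℤ) + 1 - (i + 1)).toNat = m - i by omega,
      show ((i : ℤ) + 1).toNat = i + 1 by omega, Ring.choose_neg]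
    have : (i : ℤ) + 1 + ((m - i : ℕ) : ℤ) - 1 = (m : ℕ) := by omega
    rw [this, Ring.choose_natCast, Nat.choose_symm hi]
    simp [Int.negOnePow, Units.smul_def]
    ring

/-- Both sides obey the same two-term recursion: `q^(-X)` turns the equal weights of Pascal's rule
into the ratio `q : 1`, and `(q + 1)^(n + 1)` removes the normalisation of the walk. -/
lemma A_eq_walk (q : ℕ) (hq : 2 ≤ q) (n : ℕ) : ∀ X Y : ℤ, X + Y = n + 1 →
    A X Y (1 + q) = ((q : ℂ) + 1) ^ (n + 1) * (q : ℂ) ^ (-X) * walk q n (2 * X - n) := by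
  obtain ⟨n0, n1, n2⟩ := natCast_ne hq
  induction n with
  | zero =>
    intro X Y h
    rw [walk]
    split_ifs with hX
    · obtain ⟨m, rfl⟩ : ∃ m : ℕ, X = -m := ⟨(-X).toNat, by omega⟩
      obtain rfl : Y = m + 1 := by push_cast at h; omega
      rw [A_of_add_eq_one]
      simp [add_comm]
    · rw [A, if_neg (by omega), Finset.Icc_eq_empty (by omega)]
      simp
  | succ n ih =>
    intro X Y h
    push_cast at h
    rw [A_pascal _ _ _ (by omega), ih X (Y - 1) (by omega), ih (X - 1) Y (by omega), walk]
    rw [show -(X - 1) = -X + 1 by ring, zpow_add₀ n0, zpow_one]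
    push_cast
    rw [show 2 * (X - 1) - (n : ℤ) = 2 * X - (n + 1) - 1 by ring,
      show 2 * X - (n : ℤ) = 2 * X - (n + 1) + 1 by ring]
    field_simp
    ring

lemma closedForm_eq (q : ℕ) (hq : 2 ≤ q) (x : ℤ) (t : ℕ) (ht : 0 < t) :
    (1 - 1 / (q : ℂ)) * closedForm q x t =
      walk q (2 * t - 1) (2 * x - 1) * walk q (2 * t) (2 - 2 * x) -
        (q : ℂ)⁻¹ * walk q (2 * t - 1) (3 - 2 * x) * walk q (2 * t) (2 * x) := by
  obtain ⟨n0, n1, n2⟩ := natCast_ne hq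
  obtain ⟨n, hn⟩ : ∃ n, 2 * t = n + 1 := ⟨2 * t - 1, by omega⟩
  have hs : (((√(q : ℝ) : ℝ) : ℂ)) ^ 2 = q := by
    rw [← Complex.ofReal_pow, Real.sq_sqrt (by positivity)]; simp
  rw [closedForm, A_eq_walk q hq (n + 1) _ _ (by push_cast; omega),
    A_eq_walk q hq n _ _ (by omega), A_eq_walk q hq n _ _ (by omega),
    A_eq_walk q hq (n + 1) _ _ (by push_cast; omega), hn, Nat.add_sub_cancel]
  rw [show 2 * ((t : ℤ) - x + 1) - ((n + 1 : ℕ) : ℤ) = 2 - 2 * x by omega,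
    show 2 * ((t : ℤ) + x - 1) - n = 2 * x - 1 by omega,
    show 2 * ((t : ℤ) - x + 1) - n = 3 - 2 * x by omega,
    show 2 * ((t : ℤ) + x) - ((n + 1 : ℕ) : ℤ) = 2 * x by omega]
  have h4 : 4 * t = 2 * (n + 1) := by omega
  rw [h4, div_pow, pow_mul, hs]
  have e1 : (q : ℂ) ^ (-((t : ℤ) - x + 1)) * (q : ℂ) ^ (-((t : ℤ) + x - 1)) =
      ((q : ℂ) ^ (n + 1))⁻¹ := by
    rw [← zpow_add₀ n0, ← zpow_natCast, ← _root_.zpow_neg]; congr 1; push_cast; omega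
  have e2 : (q : ℂ) ^ (-((t : ℤ) - x + 1)) * (q : ℂ) ^ (-((t : ℤ) + x)) =
      ((q : ℂ) ^ (n + 2))⁻¹ := by
    rw [← zpow_add₀ n0, ← zpow_natCast, ← _root_.zpow_neg]; congr 1; push_cast; omega
  set a := walk q n (2 * x - 1)
  set b := walk q (n + 1) (2 - 2 * x)
  set c := walk q n (3 - 2 * x)
  set d := walk q (n + 1) (2 * x)
  have f1 : ((q : ℂ) + 1) ^ (n + 1 + 1) * (q : ℂ) ^ (-((t : ℤ) - x + 1)) * b *
      (((q : ℂ) + 1) ^ (n + 1) * (q : ℂ) ^ (-((t : ℤ) + x - 1)) * a) =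
      ((q : ℂ) + 1) ^ (2 * (n + 1) + 1) * ((q : ℂ) ^ (n + 1))⁻¹ * (a * b) := by
    rw [← e1]; ring
  have f2 : ((q : ℂ) + 1) ^ (n + 1) * (q : ℂ) ^ (-((t : ℤ) - x + 1)) * c *
      (((q : ℂ) + 1) ^ (n + 1 + 1) * (q : ℂ) ^ (-((t : ℤ) + x)) * d) =
      ((q : ℂ) + 1) ^ (2 * (n + 1) + 1) * ((q : ℂ) ^ (n + 2))⁻¹ * (c * d) := by
    rw [← e2]; ring
  rw [f1, f2, show (1 : ℂ) + q = q + 1 by ring, show (q : ℂ) ^ 2 - 1 = (q + 1) * (q - 1) by ring]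
  field_simp
  ring

/-! ### Walks on the rectangle -/

/-- The biased walk in the coordinates of the rectangular lattice. -/
noncomputable def rectWalk (q x m : ℕ) : ℂ := walk q (x + m - 1) (m - x + 1)

lemma rectWalk_zero_left (q m : ℕ) : rectWalk q 0 m = 0 := walk_eq_zero q _ _ (by omega)

lemma rectWalk_zero_right (q x : ℕ) : rectWalk q (x + 1) 0 = 1 := walk_eq_one q _ _ (by omega)

/-- With the two boundary values above, this identifies `rectWalk` as the probability of reaching
the edge `m = 0` before the edge `x = 0`, for a walk that lowers `m` with probability `q / (q + 1)`.
-/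
lemma rectWalk_succ (q x m : ℕ) : rectWalk q (x + 1) (m + 1) =
    (q * rectWalk q (x + 1) m + rectWalk q x (m + 1)) / (q + 1) := by
  simp only [rectWalk]
  rw [show x + 1 + (m + 1) - 1 = x + m + 1 by omega, show x + 1 + m - 1 = x + m by omega,
    show x + (m + 1) - 1 = x + m by omega, walk]
  push_cast
  congr 4 <;> ring

/-- The probability that two walks started at `(x, a)` and `(x', b)` reach the lower edges of the
rectangle without having met. -/
noncomputable def rectDiffer (q x a x' b : ℕ) : ℂ :=
  rectWalk q x a * rectWalk q b x' -
    (q : ℂ) ^ ((a : ℤ) - x - (b - x')) * rectWalk q a x * rectWalk q x' b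

lemma rectDiffer_self (q x a : ℕ) : rectDiffer q x a x a = 0 := by
  simp [rectDiffer]; ring

/-- Lowering `b` or `x'` shifts the exponent of `q` by `+1` or `-1`, which interchanges the step
weights in the second product, so both products obey one recursion. -/
lemma rectDiffer_succ_right {q : ℕ} (hq : 2 ≤ q) (x a x' b : ℕ) :
    rectDiffer q x a (x' + 1) (b + 1) =
      1 / (q + 1) * rectDiffer q x a (x' + 1) b + q / (q + 1) * rectDiffer q x a x' (b + 1) := by
  obtain ⟨n0, n1, n2⟩ := natCast_ne hq
  simp only [rectDiffer, rectWalk_succ]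
  push_cast
  rw [show (a : ℤ) - x - (b + 1 - (x' + 1)) = a - x - (b - x') by ring,
    show (a : ℤ) - x - (b - (x' + 1)) = a - x - (b - x') + 1 by ring,
    show (a : ℤ) - x - (b + 1 - x') = a - x - (b - x') - 1 by ring]
  generalize (a : ℤ) - x - (b - x') = e
  rw [zpow_add₀ n0, zpow_sub₀ n0, zpow_one]
  field_simp
  ring

lemma rectDiffer_succ_left {q : ℕ} (hq : 2 ≤ q) (x a x' b : ℕ) :
    rectDiffer q (x + 1) (a + 1) x' b =
      1 / (q + 1) * rectDiffer q x (a + 1) x' b + q / (q + 1) * rectDiffer q (x + 1) a x' b := by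
  obtain ⟨n0, n1, n2⟩ := natCast_ne hq
  simp only [rectDiffer, rectWalk_succ]
  push_cast
  rw [show (a : ℤ) + 1 - (x + 1) - (b - x') = a - x - (b - x') by ring,
    show (a : ℤ) + 1 - x - (b - x') = a - x - (b - x') + 1 by ring,
    show (a : ℤ) - (x + 1) - (b - x') = a - x - (b - x') - 1 by ring]
  generalize (a : ℤ) - x - (b - x') = e
  rw [zpow_add₀ n0, zpow_sub₀ n0, zpow_one]
  field_simp
  ring

/-! ### Contraction of one averaged gate -/

section contraction
variable {q : ℕ}

/-- The agreement indicator of the two replicas of a leg, or the constant one. -/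
def legTest (σ : Bool) (p : Fin q × Fin q) : ℂ := if σ = true → p.1 = p.2 then 1 else 0

lemma legTest_false (p : Fin q × Fin q) : legTest false p = 1 := by simp [legTest]

lemma sum_avgGate_mul (a b : Fin q × Fin q) (F : Fin q × Fin q → Fin q × Fin q → ℂ) :
    ∑ p, ∑ p', avgGate p p' a b * F p p' = mean fun u : Gate q =>
      F ((u (a.1, b.1)).1, (u (a.2, b.2)).1) ((u (a.1, b.1)).2, (u (a.2, b.2)).2) := by
  have h : ∀ p p', avgGate p p' a b * F p p' = mean fun u : Gate q =>
      F p p' * (gateMatrix u (p.1, p'.1) (a.1, b.1) * gateMatrix u (p.2, p'.2) (a.2, b.2)) := by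
    intro p p'
    rw [mean_mul_left, mul_comm]; rfl
  simp only [h, ← mean_sum]
  congr 1
  funext u
  rw [Fintype.sum_eq_single ((u (a.1, b.1)).1, (u (a.2, b.2)).1),
    Fintype.sum_eq_single ((u (a.1, b.1)).2, (u (a.2, b.2)).2)]
  · simp [gateMatrix]
  · intro p' hp'
    by_cases h1 : p'.1 = (u (a.1, b.1)).2
    · by_cases h2 : p'.2 = (u (a.2, b.2)).2
      · exact (hp' (Prod.ext_iff.2 ⟨h1, h2⟩)).elim
      · simp [gateMatrix, Prod.ext_iff, h2]
    · simp [gateMatrix, Prod.ext_iff, h1]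
  · intro p hp
    refine Finset.sum_eq_zero fun p' _ => ?_
    by_cases h1 : p.1 = (u (a.1, b.1)).1
    · by_cases h2 : p.2 = (u (a.2, b.2)).1
      · exact (hp (Prod.ext_iff.2 ⟨h1, h2⟩)).elim
      · simp [gateMatrix, Prod.ext_iff, h2]
    · simp [gateMatrix, Prod.ext_iff, h1]

/-- Equal tests pass through the gate unchanged, by bijectivity or by normalisation; unequal tests
become a mixture of no test and both tests. -/
lemma sum_avgGate_legTest (hq : 2 ≤ q) (a b : Fin q × Fin q) (τ σ : Bool) :
    ∑ p, ∑ p', avgGate p p' a b * (legTest τ p * legTest σ p') =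
      if σ = τ then legTest τ a * legTest τ b
      else 1 / (q + 1) + q / (q + 1) * (legTest true a * legTest true b) := by
  rw [sum_avgGate_mul a b fun p p' => legTest τ p * legTest σ p']
  have hab : (legTest true a * legTest true b : ℂ) =
      if (a.1, b.1) = (a.2, b.2) then 1 else 0 := by
    simp only [legTest, forall_const, ite_zero_mul_ite_zero, mul_one, Prod.mk.injEq]
  rcases τ with _ | _ <;> rcases σ with _ | _
  · simp only [legTest_false, if_true, mul_one]; exact mean_const _
  · simp only [legTest_false, one_mul]
    rw [if_neg (by simp), hab, ← mean_gate_agree_snd hq]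
    simp [legTest]
  · simp only [legTest_false, mul_one]
    rw [if_neg (by simp), hab, ← mean_gate_agree_fst hq]
    simp [legTest]
  · rw [if_pos rfl, hab]
    simp only [legTest, forall_const, ite_zero_mul_ite_zero, mul_one, ← Prod.ext_iff,
      EmbeddingLike.apply_eq_iff_eq]
    exact mean_const _

/-! ### Contraction of one row of gates -/

/-- One row of `m` averaged gates: the incoming legs of the crossing lines are `s`, the row's own
line starts in the state `β`, and the outgoing legs are tested by `σ` and `τ`. -/
noncomputable def rowSum (β : Fin q × Fin q → ℂ) (m : ℕ) (σ : ℕ → Bool) (τ : Bool)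
    (s : Fin m → Fin q × Fin q) : ℂ :=
  ∑ l : Fin (m + 1) → Fin q × Fin q, ∑ top : Fin m → Fin q × Fin q,
    (∏ j, avgGate (l j.succ) (top j) (s j) (l j.castSucc)) * β (l 0) *
      (∏ j : Fin m, legTest (σ j) (top j)) * legTest τ (l (Fin.last m))

lemma sum_snoc {α : Type*} [Fintype α] {n : ℕ} (F : (Fin (n + 1) → α) → ℂ) :
    ∑ f, F f = ∑ g : Fin n → α, ∑ x, F (Fin.snoc g x) := by
  rw [← (Fin.snocEquiv fun _ => α).sum_comp, Fintype.sum_prod_type, Finset.sum_comm]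
  simp [Fin.snocEquiv]

lemma rowSum_zero (β : Fin q × Fin q → ℂ) (σ : ℕ → Bool) (τ : Bool)
    (s : Fin 0 → Fin q × Fin q) : rowSum β 0 σ τ s = ∑ p, β p * legTest τ p := by
  rw [rowSum, ← (Equiv.funUnique (Fin 1) (Fin q × Fin q)).symm.sum_comp]
  simp

/-- The last gate of the row is contracted first. It passes the test `τ` on the row's own line down
to the shorter row, possibly altered. -/
lemma rowSum_succ (hq : 2 ≤ q) (β : Fin q × Fin q → ℂ) (m : ℕ) (σ : ℕ → Bool) (τ : Bool)
    (s : Fin (m + 1) → Fin q × Fin q) :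
    rowSum β (m + 1) σ τ s = if σ m = τ then
      legTest τ (s (Fin.last m)) * rowSum β m σ τ fun j => s j.castSucc
    else 1 / (q + 1) * (rowSum β m σ false fun j => s j.castSucc) + q / (q + 1) *
      (legTest true (s (Fin.last m)) * rowSum β m σ true fun j => s j.castSucc) := by
  have key : rowSum β (m + 1) σ τ s = ∑ l : Fin (m + 1) → Fin q × Fin q,
      ∑ top : Fin m → Fin q × Fin q,
      ((∏ j, avgGate (l j.succ) (top j) (s j.castSucc) (l j.castSucc)) * β (l 0) *
      (∏ j : Fin m, legTest (σ j) (top j))) *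
        ∑ p, ∑ p', avgGate p p' (s (Fin.last m)) (l (Fin.last m)) *
          (legTest τ p * legTest (σ m) p') := by
    rw [rowSum, sum_snoc]
    refine Finset.sum_congr rfl fun l _ => ?_
    simp only [sum_snoc, Finset.mul_sum]
    rw [Finset.sum_comm]
    refine Finset.sum_congr rfl fun top _ => ?_
    refine Finset.sum_congr rfl fun p _ => ?_
    refine Finset.sum_congr rfl fun p' _ => ?_
    rw [Fin.prod_univ_castSucc, Fin.prod_univ_castSucc]
    simp only [← Fin.castSucc_succ, Fin.snoc_castSucc, Fin.succ_last, Fin.snoc_last,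
      Fin.val_castSucc, Fin.val_last]
    rw [← Fin.castSucc_zero, Fin.snoc_castSucc]
    ring
  rw [key]
  simp only [sum_avgGate_legTest hq]
  split_ifs with h
  · rw [rowSum]
    simp only [Finset.mul_sum]
    refine Finset.sum_congr rfl fun l _ => Finset.sum_congr rfl fun top _ => ?_
    ring
  · rw [rowSum, rowSum]
    simp only [Finset.mul_sum, ← Finset.sum_add_distrib]
    refine Finset.sum_congr rfl fun l _ => Finset.sum_congr rfl fun top _ => ?_
    rw [legTest_false]
    ring

lemma rowSum_congr (β : Fin q × Fin q → ℂ) (m : ℕ) (σ σ' : ℕ → Bool) (τ : Bool)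
    (s : Fin m → Fin q × Fin q) (h : ∀ j < m, σ j = σ' j) :
    rowSum β m σ τ s = rowSum β m σ' τ s := by
  simp only [rowSum, fun j : Fin m => h j j.2]

lemma rowSum_false (hq : 2 ≤ q) (β : Fin q × Fin q → ℂ) (hβ : ∑ p, β p = 1) (m : ℕ)
    (σ : ℕ → Bool) (s : Fin m → Fin q × Fin q) (h : ∀ j < m, σ j = false) :
    rowSum β m σ false s = 1 := by
  induction m with
  | zero => simp [rowSum_zero, legTest_false, hβ]
  | succ m ih =>
    rw [rowSum_succ hq, if_pos (h m (by omega)), legTest_false, one_mul]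
    exact ih _ fun j hj => h j (by omega)

/-! ### Contraction of the rectangle -/

/-- The distribution of a leg on which the replicas agree. -/
noncomputable def agreeDist (p : Fin q × Fin q) : ℂ := (q : ℂ)⁻¹ * legTest true p

/-- The initial distribution of the line `i`: flat for `i = 0`, in agreement otherwise. -/
noncomputable def lineDist (i : ℕ) (p : Fin q × Fin q) : ℂ :=
  if i = 0 then ((q : ℂ) ^ 2)⁻¹ else agreeDist p

/-- The distribution of the `Y` lines that cross the first `x` rows. -/
noncomputable def rectDist (Y : ℕ) : ℕ → (Fin Y → Fin q × Fin q) → ℂ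
  | 0, s => ∏ j, agreeDist (s j)
  | x + 1, top => ∑ s, ∑ l : Fin (Y + 1) → Fin q × Fin q, rectDist Y x s *
      ((∏ j, avgGate (l j.succ) (top j) (s j) (l j.castSucc)) * lineDist x (l 0))

lemma sum_rectDist_succ (Y X : ℕ) (Θ : (Fin Y → Fin q × Fin q) → ℂ) :
    ∑ s, rectDist Y (X + 1) s * Θ s = ∑ s, rectDist Y X s *
      ∑ l : Fin (Y + 1) → Fin q × Fin q, ∑ top,
        (∏ j, avgGate (l j.succ) (top j) (s j) (l j.castSucc)) * lineDist X (l 0) * Θ top := by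
  simp only [rectDist, Finset.sum_mul, Finset.mul_sum]
  rw [Finset.sum_comm]
  refine Finset.sum_congr rfl fun s _ => ?_
  rw [Finset.sum_comm]
  refine Finset.sum_congr rfl fun l _ => Finset.sum_congr rfl fun top _ => ?_
  ring

lemma sum_rectangle (Y X : ℕ) (Θ : (Fin Y → Fin q × Fin q) → ℂ) :
    ∑ l : Fin X → Fin (Y + 1) → Fin q × Fin q, ∑ r : Fin (X + 1) → Fin Y → Fin q × Fin q,
      (∏ i : Fin X, ∏ j : Fin Y,
        avgGate (l i j.succ) (r i.succ j) (r i.castSucc j) (l i j.castSucc)) *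
      (∏ j, agreeDist (r 0 j)) * (∏ i : Fin X, lineDist i (l i 0)) * Θ (r (Fin.last X)) =
    ∑ s, rectDist Y X s * Θ s := by
  induction X generalizing Θ with
  | zero =>
    simp only [Fintype.sum_unique]
    rw [← (Equiv.funUnique (Fin 1) (Fin Y → Fin q × Fin q)).symm.sum_comp]
    simp [rectDist]
  | succ X ih =>
    rw [sum_rectDist_succ, ← ih, sum_snoc]
    refine Finset.sum_congr rfl fun l _ => ?_
    simp only [sum_snoc (n := X + 1), Finset.mul_sum]
    rw [Finset.sum_comm]
    refine Finset.sum_congr rfl fun r _ => ?_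
    refine Finset.sum_congr rfl fun l' _ => ?_
    refine Finset.sum_congr rfl fun top _ => ?_
    rw [Fin.prod_univ_castSucc, Fin.prod_univ_castSucc (fun i : Fin (X + 1) => lineDist (i : ℕ) _)]
    simp only [← Fin.castSucc_succ, Fin.snoc_castSucc, Fin.succ_last, Fin.snoc_last,
      Fin.val_castSucc, Fin.val_last]
    rw [← Fin.castSucc_zero, Fin.snoc_castSucc]
    ring

end contraction
section contraction
variable {q : ℕ}

/-! ### Windows of tested lines and the value of the diagram -/

/-- The test pattern of the lines `a, …, b - 1`. -/
def window (a b j : ℕ) : Bool := decide (a ≤ j ∧ j < b)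

lemma sum_legTest_true : ∑ p : Fin q × Fin q, legTest true p = (q : ℂ) := by
  rw [Fintype.sum_prod_type]
  simp [legTest]

lemma legTest_true_mul_self (p : Fin q × Fin q) : legTest true p * legTest true p = legTest true p := by
  simp [legTest]

lemma sum_agreeDist_mul (hq : 2 ≤ q) (σ : Bool) :
    ∑ p : Fin q × Fin q, agreeDist p * legTest σ p = 1 := by
  obtain ⟨n0, n1, n2⟩ := natCast_ne hq
  cases σ
  · simp [legTest_false, agreeDist, ← Finset.mul_sum, sum_legTest_true, n0]
  · simp [agreeDist, mul_assoc, legTest_true_mul_self, ← Finset.mul_sum, sum_legTest_true, n0]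

lemma sum_lineDist (hq : 2 ≤ q) (x : ℕ) : ∑ p : Fin q × Fin q, lineDist x p = 1 := by
  obtain ⟨n0, n1, n2⟩ := natCast_ne hq
  unfold lineDist
  split_ifs with h
  · simp [← sq, n0]
  · simpa [legTest_false] using sum_agreeDist_mul hq false

/-- Induction on rows, scanning each row from its last gate down to its first. The row's own line is
untested until the scan meets the upper end of the window (`hA`), tested between the ends (`hB`),
and untested again once the lower end has crossed the row (`hC`). The arguments of `rectDiffer`
record which ends have crossed. -/
lemma sum_rectDist_window (hq : 2 ≤ q) (Y : ℕ) (x : ℕ) : ∀ a b : ℕ, a ≤ b → b ≤ Y →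
    ∑ s : Fin Y → Fin q × Fin q, rectDist Y x s * ∏ j : Fin Y, legTest (window a b j) (s j) =
      1 - (1 - 1 / (q : ℂ)) * rectDiffer q x a x b := by
  obtain ⟨n0, n1, n2⟩ := natCast_ne hq
  induction x with
  | zero =>
    intro a b _ _
    simp only [rectDist, ← Finset.prod_mul_distrib]
    have := Finset.prod_univ_sum (fun _ : Fin Y => (Finset.univ : Finset (Fin q × Fin q)))
      fun j p => agreeDist p * legTest (window a b j) p
    rw [Fintype.piFinset_univ] at this
    rw [← this]
    simp [sum_agreeDist_mul hq, rectDiffer, rectWalk_zero_left]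
  | succ x ih =>
    have hC : ∀ m (hm : m ≤ Y) a b, m ≤ a → a ≤ b → b ≤ Y →
        ∑ s : Fin Y → Fin q × Fin q, rectDist Y x s *
          ((∏ j : Fin Y, legTest (window a b j) (s j)) *
          rowSum (lineDist x) m (window a b) false fun j => s (Fin.castLE hm j)) =
        1 - (1 - 1 / (q : ℂ)) * rectDiffer q x a x b := by
      intro m hm a b hma hab hb
      rw [← ih a b hab hb]
      refine Finset.sum_congr rfl fun s _ => ?_
      rw [rowSum_false hq _ (sum_lineDist hq x), mul_one]
      intro j hj
      simp only [window, decide_eq_false_iff_not]; omega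
    have hB : ∀ m (hm : m ≤ Y) a b, a ≤ m → m < b → b ≤ Y →
        ∑ s : Fin Y → Fin q × Fin q, rectDist Y x s *
          ((∏ j : Fin Y, legTest (window m b j) (s j)) *
          rowSum (lineDist x) m (window a b) true fun j => s (Fin.castLE hm j)) =
        1 - (1 - 1 / (q : ℂ)) * rectDiffer q (x + 1) a x b := by
      intro m
      induction m with
      | zero =>
        intro hm a b ha hb hbY
        obtain rfl : a = 0 := by omega
        simp only [rowSum_zero, ← mul_assoc, ← Finset.sum_mul]
        rw [ih 0 b (by omega) hbY]
        obtain ⟨b, rfl⟩ : ∃ b', b = b' + 1 := ⟨b - 1, by omega⟩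
        -- The scan has reached the start of the row's own line with the test still on. The flat
        -- line `x = 0` passes with probability `1/q`; every other line starts in agreement and
        -- passes with certainty.
        rcases x with _ | x
        · simp [lineDist, ← Finset.mul_sum, sum_legTest_true, rectDiffer, rectWalk_zero_left,
            rectWalk_zero_right]
          field_simp
        · simp [lineDist, sum_agreeDist_mul hq, rectDiffer, rectWalk_zero_left,
            rectWalk_zero_right]
      | succ m ihm =>
        intro hm a b ha hb hbY
        have hprod : ∀ s : Fin Y → Fin q × Fin q,
            (∏ j : Fin Y, legTest (window (m + 1) b j) (s j)) * legTest true (s ⟨m, hm⟩) =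
            ∏ j : Fin Y, legTest (window m b j) (s j) := by
          intro s
          rw [← Finset.mul_prod_erase _ _ (Finset.mem_univ (⟨m, hm⟩ : Fin Y)),
            ← Finset.mul_prod_erase (Finset.univ : Finset (Fin Y))
              (fun j : Fin Y => legTest (window m b j) (s j)) (Finset.mem_univ (⟨m, hm⟩ : Fin Y))]
          have e1 : window (m + 1) b m = false := by simp [window]
          have e2 : window m b m = true := by simp [window]; omega
          rw [e1, e2, legTest_false, one_mul, mul_comm]
          congr 1
          refine Finset.prod_congr rfl fun j hj => ?_
          have hj : (j : ℕ) ≠ m := fun h => (Finset.mem_erase.1 hj).1 (Fin.ext h)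
          have : window (m + 1) b j = window m b j := by
            simp only [window, decide_eq_decide]; omega
          rw [this]
        have hlast : ∀ s : Fin Y → Fin q × Fin q,
            s (Fin.castLE hm (Fin.last m)) = s ⟨m, hm⟩ := fun s => rfl
        have hcast : ∀ (s : Fin Y → Fin q × Fin q) (j : Fin m),
            s (Fin.castLE hm j.castSucc) = s (Fin.castLE (by omega : m ≤ Y) j) := fun s j => rfl
        simp only [rowSum_succ hq, hlast, hcast]
        by_cases ham : a ≤ m
        · have e : window a b m = true := by simp [window]; omega
          rw [← ihm (by omega) a b ham (by omega) hbY]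
          refine Finset.sum_congr rfl fun s _ => ?_
          rw [if_pos e, ← mul_assoc (∏ _, _), hprod]
        -- The gate just below the window: its crossing line is untested, the row's line tested.
        -- Either the lower end crosses the row (`hC`), or the window grows by one line (`hB`).
        · obtain rfl : a = m + 1 := by omega
          have e : window (m + 1) b m = false := by simp [window]
          rw [rectDiffer_succ_left hq]
          have h1 := hC m (by omega) (m + 1) b (by omega) (by omega) hbY
          have h2 := ihm (by omega) m b le_rfl (by omega) hbY
          have h3 : ∑ s : Fin Y → Fin q × Fin q, rectDist Y x s *
              ((∏ j : Fin Y, legTest (window (m + 1) b j) (s j)) * if window (m + 1) b m = true then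
                legTest true (s ⟨m, hm⟩) * rowSum (lineDist x) m (window (m + 1) b) true
                  fun j => s (Fin.castLE (by omega : m ≤ Y) j)
              else 1 / (q + 1) * (rowSum (lineDist x) m (window (m + 1) b) false
                  fun j => s (Fin.castLE (by omega : m ≤ Y) j)) + q / (q + 1) *
                (legTest true (s ⟨m, hm⟩) * rowSum (lineDist x) m (window (m + 1) b) true
                  fun j => s (Fin.castLE (by omega : m ≤ Y) j))) =
              1 / (q + 1) * (1 - (1 - 1 / (q : ℂ)) * rectDiffer q x (m + 1) x b) + q / (q + 1) *
                (1 - (1 - 1 / (q : ℂ)) * rectDiffer q (x + 1) m x b) := by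
            rw [← h1, ← h2, Finset.mul_sum, Finset.mul_sum, ← Finset.sum_add_distrib]
            refine Finset.sum_congr rfl fun s _ => ?_
            rw [if_neg (by simp [e]), ← hprod, rowSum_congr _ m (window m b) (window (m + 1) b)]
            · ring
            · intro j hj
              simp only [window, decide_eq_decide]; omega
          rw [h3]
          field_simp
          ring
    have hA : ∀ m (hm : m ≤ Y) a b, a ≤ b → b ≤ m →
        ∑ s : Fin Y → Fin q × Fin q, rectDist Y x s *
          (rowSum (lineDist x) m (window a b) false fun j => s (Fin.castLE hm j)) =
        1 - (1 - 1 / (q : ℂ)) * rectDiffer q (x + 1) a (x + 1) b := by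
      have triv : ∀ m (hm : m ≤ Y) a,
          ∑ s : Fin Y → Fin q × Fin q, rectDist Y x s *
            (rowSum (lineDist x) m (window a a) false fun j => s (Fin.castLE hm j)) =
          1 - (1 - 1 / (q : ℂ)) * rectDiffer q (x + 1) a (x + 1) a := by
        intro m hm a
        have h := ih 0 0 le_rfl (Nat.zero_le _)
        rw [rectDiffer_self] at h ⊢
        rw [← h]
        refine Finset.sum_congr rfl fun s _ => ?_
        have hw : ∀ a j, window a a j = false := fun a j => by
          simp only [window, decide_eq_false_iff_not]; omega
        rw [rowSum_false hq _ (sum_lineDist hq x) _ _ _ fun j _ => hw a j]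
        simp [hw, legTest_false]
      intro m
      induction m with
      | zero =>
        intro hm a b hab hb
        obtain rfl : a = b := by omega
        exact triv _ _ _
      | succ m ihm =>
        intro hm a b hab hb
        rcases hab.eq_or_lt with rfl | hlt
        · exact triv _ _ _
        have hlast : ∀ s : Fin Y → Fin q × Fin q,
            s (Fin.castLE hm (Fin.last m)) = s ⟨m, hm⟩ := fun s => rfl
        have hcast : ∀ (s : Fin Y → Fin q × Fin q) (j : Fin m),
            s (Fin.castLE hm j.castSucc) = s (Fin.castLE (by omega : m ≤ Y) j) := fun s j => rfl
        simp only [rowSum_succ hq, hlast, hcast]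
        by_cases hbm : b ≤ m
        · have e : window a b m = false := by
            simp only [window, decide_eq_false_iff_not]; omega
          rw [← ihm (by omega) a b hab hbm]
          refine Finset.sum_congr rfl fun s _ => ?_
          rw [if_pos e, legTest_false, one_mul]
        -- The topmost line of the window meets the untested row line. Either the window loses this
        -- line (`ihm`), or its upper end crosses the row and the row's line becomes tested (`hB`).
        · obtain rfl : b = m + 1 := by omega
          have e : window a (m + 1) m = true := by simp [window]; omega
          have h1 := ihm (by omega) a m (by omega) le_rfl
          have h2 := hB m (by omega) a (m + 1) (by omega) (by omega) hm
          have hprod : ∀ s : Fin Y → Fin q × Fin q,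
              ∏ j : Fin Y, legTest (window m (m + 1) j) (s j) = legTest true (s ⟨m, hm⟩) := by
            intro s
            rw [Finset.prod_eq_single ⟨m, hm⟩]
            · have : window m (m + 1) m = true := by simp [window]
              rw [this]
            · intro j _ hj
              have hj : (j : ℕ) ≠ m := fun h => hj (Fin.ext h)
              have : window m (m + 1) j = false := by
                simp only [window, decide_eq_false_iff_not]; omega
              rw [this, legTest_false]
            · simp
          rw [rectDiffer_succ_right hq]
          have h3 : 1 - (1 - 1 / (q : ℂ)) * (1 / (q + 1) * rectDiffer q (x + 1) a (x + 1) m +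
                q / (q + 1) * rectDiffer q (x + 1) a x (m + 1)) =
              1 / (q + 1) * (1 - (1 - 1 / (q : ℂ)) * rectDiffer q (x + 1) a (x + 1) m) +
                q / (q + 1) * (1 - (1 - 1 / (q : ℂ)) * rectDiffer q (x + 1) a x (m + 1)) := by
            field_simp
            ring
          rw [h3, ← h1, ← h2, Finset.mul_sum, Finset.mul_sum, ← Finset.sum_add_distrib]
          refine Finset.sum_congr rfl fun s _ => ?_
          rw [if_neg (by simp [e]), hprod,
            rowSum_congr _ m (window a m) (window a (m + 1))]
          · ring
          · intro j hj
            simp only [window, decide_eq_decide]; omega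
    intro a b hab hb
    rw [sum_rectDist_succ, ← hA Y le_rfl a b hab hb]
    refine Finset.sum_congr rfl fun s _ => ?_
    simp [rowSum, legTest_false]

lemma dDiagram_eq (hq : 2 ≤ q) (X Y : ℕ) :
    dDiagram q (X + 1) (Y + 1) 1 = ((√(q : ℝ) : ℝ) : ℂ) *
      (1 - (1 - 1 / (q : ℂ)) * rectDiffer q (X + 1) Y (X + 1) (Y + 1)) := by
  obtain ⟨n0, n1, n2⟩ := natCast_ne hq
  set w : ℂ := ((√(q : ℝ) : ℝ) : ℂ) with hw
  have hs : w ^ 2 = q := by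
    rw [hw, ← Complex.ofReal_pow, Real.sq_sqrt (by positivity)]; simp
  have w0 : w ≠ 0 := by
    intro h; rw [h] at hs; exact n0 (by rw [← hs]; simp)
  have hcirc : ∀ p : Fin q × Fin q, circle₂ p = w⁻¹ * legTest true p := by
    intro p; simp [circle₂, legTest, hw]
  have hcirc' : ∀ p : Fin q × Fin q, circle₂ p = w * agreeDist p := by
    intro p; rw [hcirc, agreeDist, ← hs]; field_simp
  rw [← sum_rectDist_window hq (Y + 1) (X + 1) Y (Y + 1) (by omega) le_rfl, ← sum_rectangle,
    dDiagram]
  simp only [Finset.mul_sum]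
  refine Finset.sum_congr rfl fun l _ => ?_
  -- The diagram indexes labels by line and then height; the row contraction needs them by height
  -- first.
  rw [← (Equiv.piComm fun (_ : Fin (X + 1 + 1)) (_ : Fin (Y + 1)) => Fin q × Fin q).sum_comp]
  refine Finset.sum_congr rfl fun r _ => ?_
  simp only [Equiv.piComm_apply, Function.swap]
  have e1 : ∏ j : Fin (Y + 1), circle₂ (r 0 j) = w ^ (Y + 1) * ∏ j, agreeDist (r 0 j) := by
    simp only [hcirc', Finset.prod_mul_distrib]; simp
  have e2 : (∏ i : Fin (X + 1), if (i : ℕ) = 0 then flat₂ (l i 0) else circle₂ (l i 0)) =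
      w ^ (X + 2) * ∏ i : Fin (X + 1), lineDist i (l i 0) := by
    rw [Fin.prod_univ_succ, Fin.prod_univ_succ (fun i : Fin (X + 1) => lineDist (i : ℕ) _)]
    simp only [Fin.val_zero, if_true, Fin.val_succ, Nat.succ_ne_zero, if_false, lineDist, hcirc',
      Finset.prod_mul_distrib, flat₂]
    simp only [Finset.prod_const, Finset.card_univ, Fintype.card_fin]
    rw [← hs]; field_simp; ring
  have e3 : ∏ i : Fin (X + 1), flat₂ (l i (Fin.last (Y + 1))) = (w⁻¹) ^ (2 * (X + 1)) := by
    simp [flat₂, ← hs, pow_mul]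
  have e4 : (∏ j : Fin (Y + 1), if Y + 1 ≤ (j : ℕ) + 1 then circle₂ (r (Fin.last (X + 1)) j)
      else flat₂ (r (Fin.last (X + 1)) j)) =
      (w⁻¹) ^ (2 * Y + 1) *
        ∏ j : Fin (Y + 1), legTest (window Y (Y + 1) j) (r (Fin.last (X + 1)) j) := by
    rw [Fin.prod_univ_castSucc, Fin.prod_univ_castSucc (fun j : Fin (Y + 1) => legTest _ _)]
    have h1 : window Y (Y + 1) (Fin.last Y) = true := by simp [window]
    have h2 : ∀ j : Fin Y, window Y (Y + 1) j.castSucc = false := by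
      intro j
      simp only [window, decide_eq_false_iff_not, Fin.val_castSucc]; omega
    have h3 : ∀ j : Fin Y, ¬ (Y + 1 ≤ (j.castSucc : ℕ) + 1) := by
      intro j; simp only [Fin.val_castSucc]; omega
    rw [if_pos (by simp), h1, hcirc]
    simp only [h2, h3, if_false, legTest_false, flat₂, Finset.prod_const, Finset.card_univ,
      Fintype.card_fin, one_pow, one_mul]
    rw [← hs, ← inv_pow, pow_succ _ (2 * Y), pow_mul]
    ring
  -- All normalisations of the boundary states are powers of `√q`; with the prefactor of the diagram
  -- a single `√q` remains.
  have e5 : w ^ (X + 1 + (Y + 1) - 1) * (w ^ (Y + 1) * w ^ (X + 2) * (w⁻¹) ^ (2 * (X + 1)) *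
      (w⁻¹) ^ (2 * Y + 1)) = w := by
    rw [show X + 1 + (Y + 1) - 1 = X + Y + 1 by omega]
    simp only [inv_pow]
    field_simp
    ring
  rw [e1, e2, e3, e4]
  conv_rhs => rw [← e5]
  ring

end contraction
end RPC

/-! ### Assembly of the theorem -/

theorem mainTheorem5 (q L : ℕ) [NeZero L] (hq : 2 ≤ q) :
    -- initial value
    (∀ a : Matrix (Fin q) (Fin q) ℂ, RPC.IsPerturbation a → ∀ j : RPC.Site L,
      RPC.avgDecorrelator a j 0 = if j = 0 then 1 else 0) ∧
    -- the average does not depend on the perturbation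
    (∀ a a' : Matrix (Fin q) (Fin q) ℂ, RPC.IsPerturbation a → RPC.IsPerturbation a' →
      ∀ (j : RPC.Site L) (t : ℕ), RPC.avgDecorrelator a j t = RPC.avgDecorrelator a' j t) ∧
    -- expression through the diagram `d`, inside the light cone of the perturbation
    (∀ a : Matrix (Fin q) (Fin q) ℂ, RPC.IsPerturbation a →
      ∀ (x : ℤ) (t : ℕ), 0 < t → 2 * t ≤ L → -(t : ℤ) < x → x ≤ t →
        RPC.avgDecorrelator a ((2 * x : ℤ) : RPC.Site L) t =
          (q : ℂ) / (q - 1) - ((√(q : ℝ) : ℝ) : ℂ) / (q - 1) *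
            RPC.dDiagram q (t - x + 1).toNat (t + x).toNat 1) ∧
    -- relation with the OTOC of a diagonal and a generic observable
    (∀ a d b : Matrix (Fin q) (Fin q) ℂ, RPC.IsPerturbation a →
      RPC.IsObservable d → d.IsDiag → RPC.IsObservable b → RPC.diagWeight b ≠ 1 →
      ∀ (j : RPC.Site L) (t : ℕ), 0 < t →
        RPC.avgDecorrelator a j t =
          (1 - 1 / (q : ℂ)) / (1 - RPC.diagWeight b) * RPC.avgOtoc d b j t) ∧
    -- closed form of the OTOC
    (∀ d b : Matrix (Fin q) (Fin q) ℂ,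
      RPC.IsObservable d → d.IsDiag → RPC.IsObservable b →
      ∀ (x : ℤ) (t : ℕ), 0 < t → 2 * t ≤ L → -(L : ℤ) < 2 * x → 2 * x ≤ L →
        RPC.avgOtoc d b ((2 * x : ℤ) : RPC.Site L) t =
          (1 - RPC.diagWeight b) * RPC.closedForm q x t) ∧
    -- closed form of the decorrelator
    (∀ a : Matrix (Fin q) (Fin q) ℂ, RPC.IsPerturbation a →
      ∀ (x : ℤ) (t : ℕ), 0 < t → 2 * t ≤ L → -(L : ℤ) < 2 * x → 2 * x ≤ L →
        RPC.avgDecorrelator a ((2 * x : ℤ) : RPC.Site L) t =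
          (1 - 1 / (q : ℂ)) * RPC.closedForm q x t) ∧
    -- half-odd-integer positions
    (∀ a : Matrix (Fin q) (Fin q) ℂ, RPC.IsPerturbation a →
      ∀ (x : ℤ) (t : ℕ), 0 < t →
        RPC.avgDecorrelator a ((2 * x - 1 : ℤ) : RPC.Site L) t =
          RPC.avgDecorrelator a ((2 * x : ℤ) : RPC.Site L) t) := by
  obtain ⟨n0, n1, n2⟩ := RPC.natCast_ne hq
  have dec : ∀ a : Matrix (Fin q) (Fin q) ℂ, RPC.IsPerturbation a →
      ∀ (x : ℤ) (t : ℕ), 0 < t → 2 * t ≤ L → -(L : ℤ) < 2 * x → 2 * x ≤ L →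
        RPC.avgDecorrelator a ((2 * x : ℤ) : RPC.Site L) t =
          (1 - 1 / (q : ℂ)) * RPC.closedForm q x t := by
    intro a ha x t ht htL h1 h2
    rw [RPC.avgDecorrelator_eq hq ha _ t _ (RPC.evolMean_agree_site hq x t ht htL h1 h2),
      RPC.closedForm_eq q hq x t ht, sub_sub_cancel]
  refine ⟨?_, ?_, ?_, ?_, ?_, dec, ?_⟩
  · intro a ha j
    rw [RPC.avgDecorrelator_eq hq ha j 0 (if j = 0 then 0 else 1)]
    · split_ifs <;> simp
    · intro c s hs
      rw [mul_zero, RPC.evolMean_zero]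
      by_cases hj : j = 0
      · subst hj; simp [RPC.agree, hs.symm]
      · simp [RPC.agree, hj]
  · intro a a' ha ha' j t
    obtain ⟨w, hw⟩ := RPC.exists_evolMean_agree hq (2 * t) {j}
    rw [RPC.avgDecorrelator_eq hq ha j t w hw, RPC.avgDecorrelator_eq hq ha' j t w hw]
  · intro a ha x t ht htL h1 h2
    rw [dec a ha x t ht htL (by omega) (by omega), RPC.closedForm_eq q hq x t ht]
    obtain ⟨X, hX⟩ : ∃ X : ℕ, (t : ℤ) - x = X := ⟨((t : ℤ) - x).toNat, by omega⟩
    obtain ⟨Y, hY⟩ : ∃ Y : ℕ, (t : ℤ) + x = Y + 1 := ⟨((t : ℤ) + x - 1).toNat, by omega⟩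
    rw [show ((t : ℤ) - x + 1).toNat = X + 1 by omega, show ((t : ℤ) + x).toNat = Y + 1 by omega,
      RPC.dDiagram_eq hq]
    -- With `X = t - x` and `Y = t + x - 1`, the rectangular coordinates of a window of one line
    -- turn into the lengths and starting points of the walks in `closedForm_eq`.
    simp only [RPC.rectDiffer, RPC.rectWalk]
    rw [show X + 1 + Y - 1 = 2 * t - 1 by omega, show Y + 1 + (X + 1) - 1 = 2 * t by omega,
      show Y + (X + 1) - 1 = 2 * t - 1 by omega, show X + 1 + (Y + 1) - 1 = 2 * t by omega]
    push_cast
    rw [show (Y : ℤ) - (X + 1) + 1 = 2 * x - 1 by omega,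
      show (X : ℤ) + 1 - (Y + 1) + 1 = 2 - 2 * x by omega,
      show (X : ℤ) + 1 - Y + 1 = 3 - 2 * x by omega,
      show (Y : ℤ) + 1 - (X + 1) + 1 = 2 * x by omega,
      show (Y : ℤ) - (X + 1) - (Y + 1 - (X + 1)) = -1 by ring, _root_.zpow_neg_one]
    have hs : ((√(q : ℝ) : ℝ) : ℂ) * ((√(q : ℝ) : ℝ) : ℂ) = q := by
      rw [← Complex.ofReal_mul, Real.mul_self_sqrt (by positivity)]; simp
    rw [div_mul_eq_mul_div, ← mul_assoc ((√(q : ℝ) : ℝ) : ℂ), hs]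
    field_simp
    ring
  · intro a d b ha hd hdd hb hne j t ht
    obtain ⟨w, hw⟩ := RPC.exists_evolMean_agree hq (2 * t) {j}
    rw [RPC.avgDecorrelator_eq hq ha j t w hw, RPC.avgOtoc_eq hq hd hdd hb j t ht w hw]
    have : 1 - RPC.diagWeight b ≠ 0 := sub_ne_zero.2 hne.symm
    field_simp
  · intro d b hd hdd hb x t ht htL h1 h2
    rw [RPC.avgOtoc_eq hq hd hdd hb _ t ht _ (RPC.evolMean_agree_site hq x t ht htL h1 h2),
      sub_sub_cancel, ← RPC.closedForm_eq q hq x t ht]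
    field_simp
  · intro a ha x t ht
    obtain ⟨w, hw⟩ := RPC.exists_evolMean_agree (L := L) hq (2 * t) {((2 * x : ℤ) : RPC.Site L)}
    rw [RPC.avgDecorrelator_eq hq ha _ t w hw]
    -- The same `w` now serves the half-odd-integer site.
    rw [← RPC.evolMean_agree_half hq x t ht] at hw
    rw [RPC.avgDecorrelator_eq hq ha _ t w hw]
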